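/- Let $\eta=\mathrm{diag}(1,-1,-1,-1)$ and let all indices run over $\{0,1,2,3\}$; indices are raised with $\eta$. Let $\mathcal P$ be the unital graded-commutative complex algebra of polynomials in the variables $v_{\mu;\rho_1\dots\rho_n}$ (even) and $u_{\rho_1\dots\rho_n},\ \tilde u_{\rho_1\dots\rho_n}$ (odd), $n\ge 0$, which stand for the derivatives $d_{\rho_1}\cdots d_{\rho_n}$ of the fields $v_\mu,u,\tilde u$, are symmetric in $\rho_1,\dots,\rho_n$, and are subject to the massless field equations $\eta^{\rho\sigma}y_{\rho\sigma\rho_3\dots\rho_n}=0$ for every field $y\in\{v_\mu,u,\tilde u\}$. Write $B=d_\mu v^\mu$, let a multi-index on $B$ denote derivatives, and let $d_Q$ be the odd derivation of $\mathcal P$ with $$d_Qv_\mu=i\,d_\mu u,\qquad d_Qu=0,\qquad d_Q\tilde u=-i\,B,\qquad [d_Q,d_\mu]=0 .$$ Then $d_Q^2=0$; put $Z_Q=\ker d_Q$, $B_Q=\operatorname{im} d_Q$, $H_Q=Z_Q/B_Q$. Let $F_{\mu\nu}=d_\mu v_\nu-d_\nu v_\mu$, let $F_{\mu\nu;\rho_1\dots\rho_n}$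 be its derivatives, and let $$F^{(0)}_{\mu\nu;\rho_1\dots\rho_n}=F_{\mu\nu;\rho_1\dots\rho_n}+\frac1{n+2}\sum_{l=1}^n\left[\eta_{\mu\rho_l}B_{\nu\rho_1\dots\hat\rho_l\dots\rho_n}-\eta_{\nu\rho_l}B_{\mu\rho_1\dots\hat\rho_l\dots\rho_n}\right]\qquad(n\ge 0)$$ be its traceless part: it is antisymmetric in $\mu,\nu$, symmetric in the $\rho_l$, and traceless in all indices. Let $\mathcal P_0\subset\mathcal P$ be the subalgebra of polynomials in $u$ and the $F^{(0)}_{\mu\nu;\rho_1\dots\rho_n}$. **Theorem.** (a) Every $p\in Z_Q$ is cohomologous to an element of $\mathcal P_0$: there is $p_0\in\mathcal P_0$ with $p-p_0\in B_Q$. (b) Let $\hat{\mathcal P}_0$ be the unital graded-commutative complex algebra generated by an odd variable $u$ and even variables $F^{(0)}_{\mu\nu;\rho_1\dots\rho_n}$ ($n\ge0$), antisymmetric in $\mu,\nu$, symmetric in the $\rho_l$ and traceless in all indices, and let $\mathcal I$ be its two-sided ideal generated by the Bianchi identities $$F^{(0)}_{\mu\nu;\rho\rho_1\dots\rho_n}+F^{(0)}_{\nu\rho;\mu\rho_1\dots\rho_n}+F^{(0)}_{\rho\mu;\nu\rho_1\dots\rho_n}\qquad(n\ge0).$$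 Then the natural map $\hat{\mathcal P}_0\to\mathcal P$ takes values in $Z_Q$ and induces an isomorphism of complex vector spaces $\hat{\mathcal P}_0/\mathcal I\cong H_Q$. -/

import Mathlib

namespace GaugeCohomology

noncomputable section

/-! ### Polynomials in commuting and anticommuting variables -/

/-- The Koszul sign `(-1)^{|x||y|}`; `true` stands for odd. -/
def koszul (a b : Bool) : ℂ := if a && b then -1 else 1

section Super

variable {ι : Type} (odd : ι → Bool) (R : Set (FreeAlgebra ℂ ι))

/-- Graded commutativity of the generators, together with relators `r = 0` for `r ∈ R`. -/
inductive SuperRel : FreeAlgebra ℂ ι → FreeAlgebra ℂ ι → Prop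
  | swap (x y : ι) : SuperRel (FreeAlgebra.ι ℂ x * FreeAlgebra.ι ℂ y)
      (koszul (odd x) (odd y) • (FreeAlgebra.ι ℂ y * FreeAlgebra.ι ℂ x))
  | rel (r : FreeAlgebra ℂ ι) (hr : r ∈ R) : SuperRel r 0

/-- The unital graded-commutative complex algebra of polynomials in the variables `ι`
(`odd x = true` for Grassmann variables), modulo the relators `R`. An odd variable squares to
zero, because it anticommutes with itself. -/
def SuperPoly : Type := RingQuot (SuperRel odd R)

instance : Ring (SuperPoly odd R) := inferInstanceAs (Ring (RingQuot (SuperRel odd R)))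

instance : Algebra ℂ (SuperPoly odd R) :=
  inferInstanceAs (Algebra ℂ (RingQuot (SuperRel odd R)))

/-- The class of a noncommutative polynomial. -/
def SuperPoly.mk : FreeAlgebra ℂ ι →ₐ[ℂ] SuperPoly odd R :=
  RingQuot.mkAlgHom ℂ (SuperRel odd R)

/-- A variable, as an element of the polynomial algebra. -/
def SuperPoly.gen (x : ι) : SuperPoly odd R := SuperPoly.mk odd R (FreeAlgebra.ι ℂ x)

theorem SuperPoly.mk_ι (x : ι) :
    SuperPoly.mk odd R (FreeAlgebra.ι ℂ x) = SuperPoly.gen odd R x := rfl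

theorem SuperPoly.gen_mul_gen (x y : ι) :
    SuperPoly.gen odd R x * SuperPoly.gen odd R y =
      koszul (odd x) (odd y) • (SuperPoly.gen odd R y * SuperPoly.gen odd R x) := by
  have h : SuperPoly.mk odd R (FreeAlgebra.ι ℂ x * FreeAlgebra.ι ℂ y) = SuperPoly.mk odd R
      (koszul (odd x) (odd y) • (FreeAlgebra.ι ℂ y * FreeAlgebra.ι ℂ x)) :=
    RingQuot.mkAlgHom_rel ℂ (SuperRel.swap (odd := odd) (R := R) x y)
  simpa only [map_mul, map_smul, SuperPoly.mk_ι] using h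

theorem SuperPoly.mk_eq_zero {r : FreeAlgebra ℂ ι} (hr : r ∈ R) : SuperPoly.mk odd R r = 0 := by
  have h : SuperPoly.mk odd R r = SuperPoly.mk odd R 0 :=
    RingQuot.mkAlgHom_rel ℂ (SuperRel.rel (odd := odd) r hr)
  simpa only [map_zero] using h

theorem SuperPoly.mk_surjective : Function.Surjective (SuperPoly.mk odd R) :=
  RingQuot.mkAlgHom_surjective ℂ (SuperRel odd R)

/-- Universal property. -/
def SuperPoly.lift {A : Type} [Ring A] [Algebra ℂ A] (f : ι → A)
    (hswap : ∀ x y, f x * f y = koszul (odd x) (odd y) • (f y * f x))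
    (hrel : ∀ r ∈ R, FreeAlgebra.lift ℂ f r = 0) : SuperPoly odd R →ₐ[ℂ] A :=
  RingQuot.liftAlgHom ℂ ⟨FreeAlgebra.lift ℂ f, by
    intro a b h
    cases h with
    | swap x y => simpa using hswap x y
    | rel _ hr => simpa using hrel _ hr⟩

theorem SuperPoly.lift_mk {A : Type} [Ring A] [Algebra ℂ A] (f : ι → A)
    (hswap : ∀ x y, f x * f y = koszul (odd x) (odd y) • (f y * f x))
    (hrel : ∀ r ∈ R, FreeAlgebra.lift ℂ f r = 0) (a : FreeAlgebra ℂ ι) :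
    SuperPoly.lift odd R f hswap hrel (SuperPoly.mk odd R a) = FreeAlgebra.lift ℂ f a :=
  RingQuot.liftAlgHom_mkAlgHom_apply ℂ _ _ _

theorem SuperPoly.lift_gen {A : Type} [Ring A] [Algebra ℂ A] (f : ι → A)
    (hswap : ∀ x y, f x * f y = koszul (odd x) (odd y) • (f y * f x))
    (hrel : ∀ r ∈ R, FreeAlgebra.lift ℂ f r = 0) (x : ι) :
    SuperPoly.lift odd R f hswap hrel (SuperPoly.gen odd R x) = f x := by
  rw [SuperPoly.gen, SuperPoly.lift_mk, FreeAlgebra.lift_ι_apply]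

/-- The upper triangular matrix which encodes a graded derivation: if `D` is a graded derivation
of parity `k`, then `a ↦ !![(-1)^{k|a|} a, D a; 0, a]` is multiplicative. -/
def derivMatrix (k : Bool) (δ : ι → SuperPoly odd R) (x : ι) :
    Matrix (Fin 2) (Fin 2) (SuperPoly odd R) :=
  !![koszul k (odd x) • SuperPoly.gen odd R x, δ x; 0, SuperPoly.gen odd R x]

/-- The graded derivation of parity `k` with values `δ` on the variables, for `δ` compatible with
the relations. -/
def SuperPoly.derivation (k : Bool) (δ : ι → SuperPoly odd R)
    (hswap : ∀ x y, derivMatrix odd R k δ x * derivMatrix odd R k δ y =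
      koszul (odd x) (odd y) • (derivMatrix odd R k δ y * derivMatrix odd R k δ x))
    (hrel : ∀ r ∈ R, FreeAlgebra.lift ℂ (derivMatrix odd R k δ) r = 0) :
    SuperPoly odd R →ₗ[ℂ] SuperPoly odd R :=
  Matrix.entryLinearMap ℂ (SuperPoly odd R) (0 : Fin 2) (1 : Fin 2) ∘ₗ
    (SuperPoly.lift odd R (derivMatrix odd R k δ) hswap hrel).toLinearMap

variable (k : Bool) (δ : ι → SuperPoly odd R)
    (hswap : ∀ x y, derivMatrix odd R k δ x * derivMatrix odd R k δ y =
      koszul (odd x) (odd y) • (derivMatrix odd R k δ y * derivMatrix odd R k δ x))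
    (hrel : ∀ r ∈ R, FreeAlgebra.lift ℂ (derivMatrix odd R k δ) r = 0)

theorem SuperPoly.derivation_gen (x : ι) :
    SuperPoly.derivation odd R k δ hswap hrel (SuperPoly.gen odd R x) = δ x := by
  simp [SuperPoly.derivation, SuperPoly.lift_gen, derivMatrix]

theorem SuperPoly.derivation_one :
    SuperPoly.derivation odd R k δ hswap hrel 1 = 0 := by
  simp [SuperPoly.derivation]

/-- The graded Leibniz rule. -/
theorem SuperPoly.derivation_gen_mul (x : ι) (b : SuperPoly odd R) :
    SuperPoly.derivation odd R k δ hswap hrel (SuperPoly.gen odd R x * b) =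
      δ x * b + koszul k (odd x) •
        (SuperPoly.gen odd R x * SuperPoly.derivation odd R k δ hswap hrel b) := by
  obtain ⟨b, rfl⟩ := SuperPoly.mk_surjective odd R b
  have key : SuperPoly.lift odd R (derivMatrix odd R k δ) hswap hrel (SuperPoly.mk odd R b) 1 1
      = SuperPoly.mk odd R b ∧
      SuperPoly.lift odd R (derivMatrix odd R k δ) hswap hrel (SuperPoly.mk odd R b) 1 0 = 0 := by
    rw [SuperPoly.lift_mk]
    induction b using FreeAlgebra.induction with
    | grade0 r => simp [Matrix.algebraMap_matrix_apply]
    | grade1 x => simp [derivMatrix, SuperPoly.mk_ι]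
    | mul a b ha hb => simp [Matrix.mul_apply, Fin.sum_univ_two, ha, hb]
    | add a b ha hb => simp [ha, hb]
  simp only [SuperPoly.derivation, LinearMap.comp_apply, AlgHom.toLinearMap_apply, map_mul,
    SuperPoly.lift_gen, Matrix.entryLinearMap_apply, Matrix.mul_apply, Fin.sum_univ_two, key.1]
  simp [derivMatrix, add_comm]

/-- Sufficient condition for compatibility with graded commutativity. -/
theorem derivMatrix_swap
    (h : ∀ x y, δ x * SuperPoly.gen odd R y =
      koszul (xor k (odd x)) (odd y) • (SuperPoly.gen odd R y * δ x)) (x y : ι) :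
    derivMatrix odd R k δ x * derivMatrix odd R k δ y =
      koszul (odd x) (odd y) • (derivMatrix odd R k δ y * derivMatrix odd R k δ x) := by
  have h1 := h x y
  have h2 := h y x
  have h3 := SuperPoly.gen_mul_gen odd R x y
  ext i j
  fin_cases i <;> fin_cases j <;>
    simp [derivMatrix, Matrix.mul_apply, Fin.sum_univ_two] <;>
    (cases k <;> cases hx : odd x <;> cases hy : odd y <;>
      simp [koszul, hx, hy] at h1 h2 h3 ⊢) <;>
    simp [h1, h2, h3, add_comm]

/-- Induction over the words in the variables. -/
theorem SuperPoly.induction {p : SuperPoly odd R → Prop} (one : p 1)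
    (gen_mul : ∀ x b, p b → p (SuperPoly.gen odd R x * b))
    (add : ∀ a b, p a → p b → p (a + b)) (smul : ∀ (c : ℂ) a, p a → p (c • a))
    (a : SuperPoly odd R) : p a := by
  obtain ⟨a, rfl⟩ := SuperPoly.mk_surjective odd R a
  suffices h : ∀ b, p b → p (SuperPoly.mk odd R a * b) by simpa using h 1 one
  induction a using FreeAlgebra.induction with
  | grade0 r => intro b hb; simpa [Algebra.algebraMap_eq_smul_one] using smul r b hb
  | grade1 x => exact gen_mul x
  | mul a b ha hb => intro c hc; simpa [mul_assoc] using ha _ (hb c hc)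
  | add a b ha hb => intro c hc; simpa [add_mul] using add _ _ (ha c hc) (hb c hc)

end Super

/-! ### The massless fields on shell -/

/-- The Minkowski metric with diagonal `1, -1, -1, -1`. -/
def eta (μ ν : Fin 4) : ℂ := if μ = ν then (if μ = 0 then 1 else -1) else 0

theorem eta_sum {M : Type} [AddCommGroup M] [Module ℂ M] (f : Fin 4 → Fin 4 → M) :
    ∑ ρ, ∑ σ, eta ρ σ • f ρ σ = f 0 0 - f 1 1 - f 2 2 - f 3 3 := by
  simp [Fin.sum_univ_four, eta]
  abel

/-- The fields: the vector field `v_μ` and the ghosts `u`, `ũ`. -/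
inductive FieldName
  | v (μ : Fin 4)
  | u
  | uTilde

/-- The ghosts are Grassmann odd. -/
def FieldName.odd : FieldName → Bool
  | .v _ => false
  | .u => true
  | .uTilde => true

/-- The variables `y_{;μ₁…μₙ} = d_{μ₁}…d_{μₙ} y`: a field together with the multiset of
derivative indices (the order of the derivatives is immaterial). -/
abbrev JetVar : Type := FieldName × Multiset (Fin 4)

def JetVar.odd (x : JetVar) : Bool := x.1.odd

/-- The derivatives of the massless field equation `η^{ρσ} d_ρ d_σ y = 0`. -/
def onShell : Set (FreeAlgebra ℂ JetVar) :=
  {r | ∃ (y : FieldName) (J : Multiset (Fin 4)),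
    r = ∑ ρ, ∑ σ, eta ρ σ • FreeAlgebra.ι ℂ ((y, ρ ::ₘ σ ::ₘ J) : JetVar)}

/-- The algebra `𝒫` of polynomials in the on-shell fields and their derivatives. -/
abbrev P : Type := SuperPoly JetVar.odd onShell

/-- The element `y_{;J}` of `𝒫`. -/
def jet (y : FieldName) (J : Multiset (Fin 4)) : P := SuperPoly.gen JetVar.odd onShell (y, J)

theorem jet_onShell (y : FieldName) (J : Multiset (Fin 4)) :
    ∑ ρ, ∑ σ, eta ρ σ • jet y (ρ ::ₘ σ ::ₘ J) = 0 := by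
  have h := SuperPoly.mk_eq_zero JetVar.odd onShell ⟨y, J, rfl⟩
  simpa only [map_sum, map_smul, SuperPoly.mk_ι, jet] using h

theorem jet_mul_jet (x y : FieldName) (J K : Multiset (Fin 4)) :
    jet x J * jet y K = koszul x.odd y.odd • (jet y K * jet x J) :=
  SuperPoly.gen_mul_gen JetVar.odd onShell (x, J) (y, K)

/-- `B_{;J}`, the derivatives of `B = d_μ v^μ`. -/
def B (J : Multiset (Fin 4)) : P := ∑ ρ, ∑ σ, eta ρ σ • jet (.v σ) (ρ ::ₘ J)

theorem B_onShell (J : Multiset (Fin 4)) :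
    ∑ ρ, ∑ σ, eta ρ σ • B (ρ ::ₘ σ ::ₘ J) = 0 := by
  have h := fun (μ ν : Fin 4) => jet_onShell (.v μ) (ν ::ₘ J)
  have hc : ∀ a b : Fin 4, a ::ₘ b ::ₘ b ::ₘ J = b ::ₘ b ::ₘ a ::ₘ J := fun a b => by
    rw [Multiset.cons_swap a b, Multiset.cons_swap a b]
  have hB : ∀ b, B (b ::ₘ b ::ₘ J) = jet (.v 0) (b ::ₘ b ::ₘ 0 ::ₘ J)
      - jet (.v 1) (b ::ₘ b ::ₘ 1 ::ₘ J) - jet (.v 2) (b ::ₘ b ::ₘ 2 ::ₘ J)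
      - jet (.v 3) (b ::ₘ b ::ₘ 3 ::ₘ J) := fun b => by
    simp only [B, eta_sum, hc 0, hc 1, hc 2, hc 3]
  simp only [eta_sum] at h
  simp only [eta_sum, hB]
  linear_combination (norm := abel) h 0 0 - h 1 1 - h 2 2 - h 3 3

theorem jet_mul_B (y : FieldName) (J K : Multiset (Fin 4)) : jet y J * B K = B K * jet y J := by
  simp only [B, eta_sum, mul_sub, sub_mul]
  simp [jet_mul_jet y (.v _), koszul, FieldName.odd]

/-! ### The formal derivatives and the gauge charge differential -/

/-- The value of `d_μ` on the variables. -/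
def formalDerivVar (μ : Fin 4) (x : JetVar) : P := jet x.1 (μ ::ₘ x.2)

theorem formalDerivVar_swap (μ : Fin 4) (x y : JetVar) :
    derivMatrix JetVar.odd onShell false (formalDerivVar μ) x *
      derivMatrix JetVar.odd onShell false (formalDerivVar μ) y = koszul x.odd y.odd •
        (derivMatrix JetVar.odd onShell false (formalDerivVar μ) y *
          derivMatrix JetVar.odd onShell false (formalDerivVar μ) x) :=
  derivMatrix_swap _ _ _ _ (by
    rintro ⟨x, J⟩ ⟨y, K⟩
    simpa [formalDerivVar, JetVar.odd, jet] using jet_mul_jet x y (μ ::ₘ J) K) x y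

theorem formalDerivVar_rel (μ : Fin 4) (r : FreeAlgebra ℂ JetVar) (hr : r ∈ onShell) :
    FreeAlgebra.lift ℂ (derivMatrix JetVar.odd onShell false (formalDerivVar μ)) r = 0 := by
  obtain ⟨y, J, rfl⟩ := hr
  have h1 := jet_onShell y J
  have h2 := jet_onShell y (μ ::ₘ J)
  have hc : ∀ b : Fin 4, μ ::ₘ b ::ₘ b ::ₘ J = b ::ₘ b ::ₘ μ ::ₘ J := fun b => by
    rw [Multiset.cons_swap μ b, Multiset.cons_swap μ b]
  have h5 : ∀ K, SuperPoly.gen JetVar.odd onShell (y, K) = jet y K := fun K => rfl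
  simp only [eta_sum] at h1 h2
  simp only [map_sum, map_smul, FreeAlgebra.lift_ι_apply, eta_sum]
  ext i j
  fin_cases i <;> fin_cases j <;>
    simp [derivMatrix, formalDerivVar, koszul, hc, h1, h2, h5]

/-- The formal derivative `d_μ`, an even derivation of `𝒫`. -/
def formalDeriv (μ : Fin 4) : P →ₗ[ℂ] P :=
  SuperPoly.derivation JetVar.odd onShell false (formalDerivVar μ)
    (formalDerivVar_swap μ) (formalDerivVar_rel μ)

theorem formalDeriv_jet (μ : Fin 4) (y : FieldName) (J : Multiset (Fin 4)) :
    formalDeriv μ (jet y J) = jet y (μ ::ₘ J) :=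
  SuperPoly.derivation_gen _ _ _ _ _ _ _

theorem formalDeriv_one (μ : Fin 4) : formalDeriv μ 1 = 0 :=
  SuperPoly.derivation_one _ _ _ _ _ _

theorem formalDeriv_jet_mul (μ : Fin 4) (y : FieldName) (J : Multiset (Fin 4)) (b : P) :
    formalDeriv μ (jet y J * b) = jet y (μ ::ₘ J) * b + jet y J * formalDeriv μ b := by
  have h := SuperPoly.derivation_gen_mul JetVar.odd onShell false (formalDerivVar μ)
    (formalDerivVar_swap μ) (formalDerivVar_rel μ) (y, J) b
  simp only [koszul, Bool.false_and, Bool.false_eq_true, if_false, one_smul] at h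
  exact h

theorem formalDeriv_B (μ : Fin 4) (J : Multiset (Fin 4)) : formalDeriv μ (B J) = B (μ ::ₘ J) := by
  simp only [B, map_sum, map_smul, formalDeriv_jet, Multiset.cons_swap μ]

/-- The value of `d_Q` on the variables: `d_Q v_{μ;J} = i u_{;μJ}`, `d_Q u_{;J} = 0`,
`d_Q ũ_{;J} = -i B_{;J}`. These are forced by the values on `v_μ`, `u`, `ũ` and by
`[d_Q, d_μ] = 0`. -/
def dQVar : JetVar → P
  | (.v μ, J) => Complex.I • jet .u (μ ::ₘ J)
  | (.u, _) => 0
  | (.uTilde, J) => -(Complex.I • B J)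

theorem dQVar_swap (x y : JetVar) :
    derivMatrix JetVar.odd onShell true dQVar x * derivMatrix JetVar.odd onShell true dQVar y =
      koszul x.odd y.odd • (derivMatrix JetVar.odd onShell true dQVar y *
        derivMatrix JetVar.odd onShell true dQVar x) :=
  derivMatrix_swap _ _ _ _ (by
    rintro ⟨x, J⟩ ⟨y, K⟩
    change dQVar (x, J) * jet y K = _ • (jet y K * dQVar (x, J))
    cases x with
    | v μ =>
      simp [dQVar, JetVar.odd, FieldName.odd, jet_mul_jet .u y, smul_comm Complex.I]
    | u => simp [dQVar]
    | uTilde => simp [dQVar, jet_mul_B, JetVar.odd, FieldName.odd, koszul]) x y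

theorem dQVar_rel (r : FreeAlgebra ℂ JetVar) (hr : r ∈ onShell) :
    FreeAlgebra.lift ℂ (derivMatrix JetVar.odd onShell true dQVar) r = 0 := by
  obtain ⟨y, J, rfl⟩ := hr
  have h1 := jet_onShell y J
  have h2 := B_onShell J
  have h3 := fun μ => jet_onShell .u (μ ::ₘ J)
  have hc : ∀ μ b : Fin 4, b ::ₘ b ::ₘ μ ::ₘ J = μ ::ₘ b ::ₘ b ::ₘ J := fun μ b => by
    rw [Multiset.cons_swap μ b, Multiset.cons_swap μ b]
  simp only [eta_sum, hc] at h1 h2 h3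
  have h4 : dQVar (y, 0 ::ₘ 0 ::ₘ J) - dQVar (y, 1 ::ₘ 1 ::ₘ J) - dQVar (y, 2 ::ₘ 2 ::ₘ J)
      - dQVar (y, 3 ::ₘ 3 ::ₘ J) = 0 := by
    cases y with
    | v μ => simp only [dQVar, ← smul_sub, h3, smul_zero]
    | u => simp [dQVar]
    | uTilde =>
      simp only [dQVar]
      linear_combination (norm := module) (-Complex.I) • h2
  have h5 : ∀ K, SuperPoly.gen JetVar.odd onShell (y, K) = jet y K := fun K => rfl
  simp only [map_sum, map_smul, FreeAlgebra.lift_ι_apply, eta_sum]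
  ext i j
  fin_cases i <;> fin_cases j <;>
    simp [derivMatrix, JetVar.odd, ← smul_sub, h1, h4, h5]

/-- The differential `d_Q`, an odd derivation of `𝒫`. -/
def dQ : P →ₗ[ℂ] P :=
  SuperPoly.derivation JetVar.odd onShell true dQVar dQVar_swap dQVar_rel

theorem dQ_jet (y : FieldName) (J : Multiset (Fin 4)) : dQ (jet y J) = dQVar (y, J) :=
  SuperPoly.derivation_gen _ _ _ _ _ _ _

theorem dQ_one : dQ 1 = 0 := SuperPoly.derivation_one _ _ _ _ _ _

theorem dQ_jet_mul (y : FieldName) (J : Multiset (Fin 4)) (b : P) :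
    dQ (jet y J * b) = dQVar (y, J) * b + koszul true y.odd • (jet y J * dQ b) :=
  SuperPoly.derivation_gen_mul _ _ _ _ _ _ _ _

theorem dQ_dQVar_mul (y : FieldName) (J : Multiset (Fin 4)) (b : P) :
    dQ (dQVar (y, J) * b) = -koszul true y.odd • (dQVar (y, J) * dQ b) := by
  cases y with
  | v μ => simp [dQVar, dQ_jet_mul, koszul, FieldName.odd]
  | u => simp [dQVar]
  | uTilde =>
    have h := jet_onShell .u J
    simp only [eta_sum] at h
    have h' : dQ (B J * b) = B J * dQ b := by
      simp only [B, eta_sum, sub_mul, map_sub, dQ_jet_mul]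
      have h6 := congrArg (fun z => Complex.I • (z * b)) h
      simp only [sub_mul, zero_mul, smul_zero, smul_sub] at h6
      simp only [dQVar, koszul, FieldName.odd, Bool.and_false, Bool.false_eq_true, if_false,
        one_smul, smul_mul_assoc]
      linear_combination (norm := abel) h6
    simp [dQVar, koszul, FieldName.odd, h']

theorem dQ_dQ (p : P) : dQ (dQ p) = 0 := by
  induction p using SuperPoly.induction with
  | one => simp [dQ_one]
  | gen_mul x b hb =>
    change dQ (dQ (jet x.1 x.2 * b)) = 0
    rw [dQ_jet_mul, map_add, dQ_dQVar_mul, map_smul, dQ_jet_mul, hb]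
    simp
  | add a b ha hb => simp [ha, hb]
  | smul c a ha => simp [ha]

/-- `[d_Q, d_μ] = 0`. -/
theorem dQ_formalDeriv (μ : Fin 4) (p : P) : dQ (formalDeriv μ p) = formalDeriv μ (dQ p) := by
  induction p using SuperPoly.induction with
  | one => simp [dQ_one, formalDeriv_one]
  | gen_mul x b hb =>
    obtain ⟨y, J⟩ := x
    change dQ (formalDeriv μ (jet y J * b)) = formalDeriv μ (dQ (jet y J * b))
    have h : formalDeriv μ (dQVar (y, J) * b) =
        dQVar (y, μ ::ₘ J) * b + dQVar (y, J) * formalDeriv μ b := by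
      cases y with
      | v ν => simp [dQVar, formalDeriv_jet_mul, Multiset.cons_swap μ ν]
      | u => simp [dQVar]
      | uTilde =>
        simp only [dQVar, neg_mul, smul_mul_assoc, map_neg, map_smul]
        rw [← neg_add, ← smul_add]
        congr 2
        simp only [B, eta_sum, sub_mul, map_sub, formalDeriv_jet_mul, Multiset.cons_swap μ]
        abel
    rw [formalDeriv_jet_mul, map_add, dQ_jet_mul, dQ_jet_mul, dQ_jet_mul, map_add, map_smul, h,
      formalDeriv_jet_mul, hb, smul_add]
    abel
  | add a b ha hb => simp [ha, hb]
  | smul c a ha => simp [ha]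

/-- The cocycles `Z_Q`. -/
def ZQ : Submodule ℂ P := LinearMap.ker dQ

/-- The coboundaries `B_Q`. -/
def BQ : Submodule ℂ P := LinearMap.range dQ

/-- The coboundaries are cocycles. -/
theorem BQ_le_ZQ : BQ ≤ ZQ := by
  rintro _ ⟨p, rfl⟩
  exact dQ_dQ p

/-- The cohomology `H_Q = Z_Q / B_Q`. -/
abbrev HQ : Type := ZQ ⧸ BQ.submoduleOf ZQ

/-- The cohomology class of a cocycle. -/
def HQ.mk : ZQ →ₗ[ℂ] HQ := (BQ.submoduleOf ZQ).mkQ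

/-! ### The traceless field strengths -/

/-- `F_{μν;J}`, the derivatives of the field strength `F_{μν} = v_{ν;μ} - v_{μ;ν}`. -/
def F (μ ν : Fin 4) (J : Multiset (Fin 4)) : P := jet (.v ν) (μ ::ₘ J) - jet (.v μ) (ν ::ₘ J)

/-- The sum over `l` of `η_{μρ_l} B_{;νρ₁…ρ̂_l…ρₙ} - η_{νρ_l} B_{;μρ₁…ρ̂_l…ρₙ}`. -/
def traceTerm (μ ν : Fin 4) (J : Multiset (Fin 4)) : P :=
  (J.map fun ρ => eta μ ρ • B (ν ::ₘ J.erase ρ) - eta ν ρ • B (μ ::ₘ J.erase ρ)).sum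

/-- The traceless part `F⁽⁰⁾_{μν;ρ₁…ρₙ}` of `F_{μν;ρ₁…ρₙ}`: one adds `1 / (n + 2)` times
`∑_l (η_{μρ_l} B_{;νρ₁…ρ̂_l…ρₙ} - η_{νρ_l} B_{;μρ₁…ρ̂_l…ρₙ})`. -/
def F0 (μ ν : Fin 4) (J : Multiset (Fin 4)) : P :=
  F μ ν J + (1 / ((J.card : ℂ) + 2)) • traceTerm μ ν J

theorem traceTerm_cons (μ ν ρ : Fin 4) (J : Multiset (Fin 4)) :
    traceTerm μ ν (ρ ::ₘ J) = (eta μ ρ • B (ν ::ₘ J) - eta ν ρ • B (μ ::ₘ J)) +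
      (J.map fun τ => eta μ τ • B (ν ::ₘ ρ ::ₘ J.erase τ) -
        eta ν τ • B (μ ::ₘ ρ ::ₘ J.erase τ)).sum := by
  rw [traceTerm, Multiset.map_cons, Multiset.sum_cons, Multiset.erase_cons_head]
  congr 2
  refine Multiset.map_congr rfl fun τ hτ => ?_
  rw [Multiset.erase_cons_tail_of_mem hτ]

theorem F0_antisymm (μ ν : Fin 4) (J : Multiset (Fin 4)) : F0 μ ν J + F0 ν μ J = 0 := by
  have h : traceTerm μ ν J + traceTerm ν μ J = 0 := by
    rw [traceTerm, traceTerm, ← Multiset.sum_map_add]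
    simp
  rw [F0, F0, F, F]
  linear_combination (norm := module) (1 / ((J.card : ℂ) + 2)) • h

theorem traceTerm_trace_deriv (μ ν : Fin 4) (J : Multiset (Fin 4)) :
    ∑ ρ, ∑ σ, eta ρ σ • traceTerm μ ν (ρ ::ₘ σ ::ₘ J) = 0 := by
  have h : ∀ ρ, traceTerm μ ν (ρ ::ₘ ρ ::ₘ J) =
      (2 : ℂ) • (eta μ ρ • B (ν ::ₘ ρ ::ₘ J) - eta ν ρ • B (μ ::ₘ ρ ::ₘ J)) +
      (J.map fun τ => eta μ τ • B (ρ ::ₘ ρ ::ₘ ν ::ₘ J.erase τ) -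
        eta ν τ • B (ρ ::ₘ ρ ::ₘ μ ::ₘ J.erase τ)).sum := fun ρ => by
    have hm : ∀ τ ∈ J, eta μ τ • B (ν ::ₘ ρ ::ₘ (ρ ::ₘ J).erase τ) -
        eta ν τ • B (μ ::ₘ ρ ::ₘ (ρ ::ₘ J).erase τ) =
        eta μ τ • B (ρ ::ₘ ρ ::ₘ ν ::ₘ J.erase τ) -
        eta ν τ • B (ρ ::ₘ ρ ::ₘ μ ::ₘ J.erase τ) := fun τ hτ => by
      rw [Multiset.erase_cons_tail_of_mem hτ, Multiset.cons_swap ν ρ, Multiset.cons_swap ν ρ,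
        Multiset.cons_swap μ ρ, Multiset.cons_swap μ ρ]
    rw [traceTerm_cons, Multiset.map_cons, Multiset.sum_cons, Multiset.erase_cons_head,
      Multiset.map_congr rfl hm]
    module
  have h0 := fun K => B_onShell K
  simp only [eta_sum] at h0 ⊢
  have hs : ∀ K : Multiset (Fin 4), (K.map fun τ =>
      ((eta μ τ • B (0 ::ₘ 0 ::ₘ ν ::ₘ J.erase τ) - eta ν τ • B (0 ::ₘ 0 ::ₘ μ ::ₘ J.erase τ)))).sum
      - (K.map fun τ => ((eta μ τ • B (1 ::ₘ 1 ::ₘ ν ::ₘ J.erase τ)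
        - eta ν τ • B (1 ::ₘ 1 ::ₘ μ ::ₘ J.erase τ)))).sum
      - (K.map fun τ => ((eta μ τ • B (2 ::ₘ 2 ::ₘ ν ::ₘ J.erase τ)
        - eta ν τ • B (2 ::ₘ 2 ::ₘ μ ::ₘ J.erase τ)))).sum
      - (K.map fun τ => ((eta μ τ • B (3 ::ₘ 3 ::ₘ ν ::ₘ J.erase τ)
        - eta ν τ • B (3 ::ₘ 3 ::ₘ μ ::ₘ J.erase τ)))).sum = 0 := fun K => by
    rw [← Multiset.sum_map_sub, ← Multiset.sum_map_sub, ← Multiset.sum_map_sub]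
    refine Multiset.sum_eq_zero fun z hz => ?_
    obtain ⟨τ, -, rfl⟩ := Multiset.mem_map.1 hz
    linear_combination (norm := module)
      eta μ τ • h0 (ν ::ₘ J.erase τ) - eta ν τ • h0 (μ ::ₘ J.erase τ)
  have hd : (eta μ 0 • B (ν ::ₘ 0 ::ₘ J) - eta ν 0 • B (μ ::ₘ 0 ::ₘ J))
      - (eta μ 1 • B (ν ::ₘ 1 ::ₘ J) - eta ν 1 • B (μ ::ₘ 1 ::ₘ J))
      - (eta μ 2 • B (ν ::ₘ 2 ::ₘ J) - eta ν 2 • B (μ ::ₘ 2 ::ₘ J))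
      - (eta μ 3 • B (ν ::ₘ 3 ::ₘ J) - eta ν 3 • B (μ ::ₘ 3 ::ₘ J)) = 0 := by
    have hc := Multiset.cons_swap μ ν J
    fin_cases μ <;> fin_cases ν <;> simp [eta] at hc ⊢ <;> simp [hc]
  simp only [h]
  linear_combination (norm := module) (2 : ℂ) • hd + hs J

theorem F0_trace_deriv (μ ν : Fin 4) (J : Multiset (Fin 4)) :
    ∑ ρ, ∑ σ, eta ρ σ • F0 μ ν (ρ ::ₘ σ ::ₘ J) = 0 := by
  have h1 := traceTerm_trace_deriv μ ν J
  have h2 := jet_onShell (.v ν) (μ ::ₘ J)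
  have h3 := jet_onShell (.v μ) (ν ::ₘ J)
  have hc : ∀ a b : Fin 4, a ::ₘ b ::ₘ b ::ₘ J = b ::ₘ b ::ₘ a ::ₘ J := fun a b => by
    rw [Multiset.cons_swap a b, Multiset.cons_swap a b]
  simp only [eta_sum, F0, F, Multiset.card_cons, hc μ, hc ν] at h1 h2 h3 ⊢
  linear_combination (norm := module) h2 - h3 + (1 / (((J.card + 1 + 1 : ℕ) : ℂ) + 2)) • h1

theorem traceTerm_trace (ν : Fin 4) (J : Multiset (Fin 4)) :
    ∑ μ, ∑ ρ, eta μ ρ • traceTerm μ ν (ρ ::ₘ J) = ((J.card : ℂ) + 3) • B (ν ::ₘ J) := by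
  have h0 := fun K => B_onShell K
  simp only [eta_sum, traceTerm_cons] at h0 ⊢
  have hs : (J.map fun τ => eta 0 τ • B (ν ::ₘ 0 ::ₘ J.erase τ)
        - eta ν τ • B (0 ::ₘ 0 ::ₘ J.erase τ)).sum
      - (J.map fun τ => eta 1 τ • B (ν ::ₘ 1 ::ₘ J.erase τ)
        - eta ν τ • B (1 ::ₘ 1 ::ₘ J.erase τ)).sum
      - (J.map fun τ => eta 2 τ • B (ν ::ₘ 2 ::ₘ J.erase τ)
        - eta ν τ • B (2 ::ₘ 2 ::ₘ J.erase τ)).sum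
      - (J.map fun τ => eta 3 τ • B (ν ::ₘ 3 ::ₘ J.erase τ)
        - eta ν τ • B (3 ::ₘ 3 ::ₘ J.erase τ)).sum = (J.card : ℂ) • B (ν ::ₘ J) := by
    rw [← Multiset.sum_map_sub, ← Multiset.sum_map_sub, ← Multiset.sum_map_sub,
      Multiset.map_congr (g := fun _ => B (ν ::ₘ J)) rfl, Multiset.map_const', Multiset.sum_replicate,
      Nat.cast_smul_eq_nsmul]
    intro τ hτ
    have h1 : eta 0 τ • B (ν ::ₘ 0 ::ₘ J.erase τ) - eta 1 τ • B (ν ::ₘ 1 ::ₘ J.erase τ)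
        - eta 2 τ • B (ν ::ₘ 2 ::ₘ J.erase τ) - eta 3 τ • B (ν ::ₘ 3 ::ₘ J.erase τ)
        = B (ν ::ₘ J) := by
      conv_rhs => rw [← Multiset.cons_erase hτ]
      generalize J.erase τ = K
      fin_cases τ <;> simp [eta]
    linear_combination (norm := module) h1 - eta ν τ • h0 (J.erase τ)
  have hd : eta ν 0 • B (0 ::ₘ J) - eta ν 1 • B (1 ::ₘ J) - eta ν 2 • B (2 ::ₘ J)
      - eta ν 3 • B (3 ::ₘ J) = B (ν ::ₘ J) := by
    fin_cases ν <;> simp [eta]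
  have he : eta 0 0 = 1 ∧ eta 1 1 = -1 ∧ eta 2 2 = -1 ∧ eta 3 3 = -1 := by simp [eta]
  rw [he.1, he.2.1, he.2.2.1, he.2.2.2]
  linear_combination (norm := module) hs - hd

theorem F0_trace (ν : Fin 4) (J : Multiset (Fin 4)) :
    ∑ μ, ∑ ρ, eta μ ρ • F0 μ ν (ρ ::ₘ J) = 0 := by
  have h1 := traceTerm_trace ν J
  have h2 := jet_onShell (.v ν) J
  have hn : (J.card : ℂ) + 3 ≠ 0 := by exact_mod_cast (by omega : J.card + 3 ≠ 0)
  have h3 : (1 / (((J.card + 1 : ℕ) : ℂ) + 2)) * ((J.card : ℂ) + 3) = 1 := by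
    push_cast
    rw [add_assoc, show (1 + 2 : ℂ) = 3 by norm_num]
    field_simp
  have h4 : B (ν ::ₘ J) = jet (.v 0) (ν ::ₘ 0 ::ₘ J) - jet (.v 1) (ν ::ₘ 1 ::ₘ J)
      - jet (.v 2) (ν ::ₘ 2 ::ₘ J) - jet (.v 3) (ν ::ₘ 3 ::ₘ J) := by
    simp only [B, eta_sum, Multiset.cons_swap ν]
  have h5 := congrArg (fun z => (1 / (((J.card + 1 : ℕ) : ℂ) + 2)) • z) h1
  simp only [smul_smul, h3, one_smul] at h5
  simp only [eta_sum, F0, F, Multiset.card_cons] at h2 h5 ⊢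
  linear_combination (norm := module) h2 + h5 + h4

theorem F0_bianchi (μ ν ρ : Fin 4) (J : Multiset (Fin 4)) :
    F0 μ ν (ρ ::ₘ J) + F0 ν ρ (μ ::ₘ J) + F0 ρ μ (ν ::ₘ J) = 0 := by
  have hη : ∀ a b, eta a b = eta b a := fun a b => by
    unfold eta
    by_cases h : a = b <;> simp [h, eq_comm]
  have h : traceTerm μ ν (ρ ::ₘ J) + traceTerm ν ρ (μ ::ₘ J) + traceTerm ρ μ (ν ::ₘ J) = 0 := by
    have hs : (J.map fun τ => eta μ τ • B (ν ::ₘ ρ ::ₘ J.erase τ)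
          - eta ν τ • B (μ ::ₘ ρ ::ₘ J.erase τ)).sum
        + (J.map fun τ => eta ν τ • B (ρ ::ₘ μ ::ₘ J.erase τ)
          - eta ρ τ • B (ν ::ₘ μ ::ₘ J.erase τ)).sum
        + (J.map fun τ => eta ρ τ • B (μ ::ₘ ν ::ₘ J.erase τ)
          - eta μ τ • B (ρ ::ₘ ν ::ₘ J.erase τ)).sum = 0 := by
      rw [← Multiset.sum_map_add, ← Multiset.sum_map_add]
      refine Multiset.sum_eq_zero fun z hz => ?_
      obtain ⟨τ, -, rfl⟩ := Multiset.mem_map.1 hz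
      rw [Multiset.cons_swap ν ρ, Multiset.cons_swap μ ρ, Multiset.cons_swap μ ν]
      abel
    simp only [traceTerm_cons]
    rw [hη ν μ, hη ρ μ, hη ρ ν]
    linear_combination (norm := abel) hs
  simp only [F0, F, Multiset.card_cons]
  rw [Multiset.cons_swap μ ρ, Multiset.cons_swap ν ρ, Multiset.cons_swap ν μ]
  linear_combination (norm := module) (1 / (((J.card + 1 : ℕ) : ℂ) + 2)) • h

theorem dQ_B (J : Multiset (Fin 4)) : dQ (B J) = 0 := by
  have h := jet_onShell .u J
  simp only [eta_sum] at h
  simp only [B, eta_sum, map_sub, dQ_jet, dQVar]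
  linear_combination (norm := module) Complex.I • h

theorem dQ_F0 (μ ν : Fin 4) (J : Multiset (Fin 4)) : dQ (F0 μ ν J) = 0 := by
  have h : dQ (traceTerm μ ν J) = 0 := by
    rw [traceTerm, map_multiset_sum, Multiset.map_map]
    refine Multiset.sum_eq_zero fun z hz => ?_
    obtain ⟨τ, -, rfl⟩ := Multiset.mem_map.1 hz
    simp [dQ_B]
  simp [F0, F, dQ_jet, dQVar, h, Multiset.cons_swap μ ν]

theorem jet_mul_F0 (y : FieldName) (K : Multiset (Fin 4)) (μ ν : Fin 4) (J : Multiset (Fin 4)) :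
    jet y K * F0 μ ν J = F0 μ ν J * jet y K := by
  have h : jet y K * traceTerm μ ν J = traceTerm μ ν J * jet y K := by
    rw [traceTerm, ← Multiset.sum_map_mul_left, ← Multiset.sum_map_mul_right]
    simp [mul_sub, sub_mul, jet_mul_B]
  simp [F0, F, mul_add, add_mul, mul_sub, sub_mul, h, jet_mul_jet y (.v _), koszul, FieldName.odd]

theorem F0_mul_F0 (μ ν : Fin 4) (J : Multiset (Fin 4)) (μ' ν' : Fin 4) (J' : Multiset (Fin 4)) :
    F0 μ ν J * F0 μ' ν' J' = F0 μ' ν' J' * F0 μ ν J := by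
  have hB : ∀ K, B K * F0 μ' ν' J' = F0 μ' ν' J' * B K := fun K => by
    simp [B, eta_sum, sub_mul, mul_sub, jet_mul_F0]
  have h : traceTerm μ ν J * F0 μ' ν' J' = F0 μ' ν' J' * traceTerm μ ν J := by
    rw [traceTerm, ← Multiset.sum_map_mul_left, ← Multiset.sum_map_mul_right]
    simp [mul_sub, sub_mul, hB]
  rw [F0, add_mul, mul_add, F, sub_mul, mul_sub, jet_mul_F0, jet_mul_F0, smul_mul_assoc, h,
    mul_smul_comm]

/-- The subspace `𝒫₀ ⊂ 𝒫` of polynomials in `u` and the `F⁽⁰⁾_{μν;ρ₁…ρₙ}`. -/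
def P0 : Subalgebra ℂ P :=
  Algebra.adjoin ℂ ({jet .u 0} ∪ {x | ∃ μ ν J, x = F0 μ ν J})

/-! ### Polynomials in `u` and a traceless tensor, and the Bianchi identities -/

/-- The variables `u` and `F⁽⁰⁾_{μν;J}`, as formal symbols. -/
inductive PhysVar
  | u
  | F0 (μ ν : Fin 4) (J : Multiset (Fin 4))

def PhysVar.odd : PhysVar → Bool
  | .u => true
  | .F0 _ _ _ => false

/-- `F⁽⁰⁾_{μν;ρ₁…ρₙ}` is antisymmetric in `μ, ν` and traceless in all indices; the symmetry in
the `ρ`s is built into the multiset `J`. -/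
inductive TracelessRelator : FreeAlgebra ℂ PhysVar → Prop
  | antisymm (μ ν : Fin 4) (J : Multiset (Fin 4)) : TracelessRelator
      (FreeAlgebra.ι ℂ (PhysVar.F0 μ ν J) + FreeAlgebra.ι ℂ (PhysVar.F0 ν μ J))
  | trace_deriv (μ ν : Fin 4) (J : Multiset (Fin 4)) : TracelessRelator
      (∑ ρ, ∑ σ, eta ρ σ • FreeAlgebra.ι ℂ (PhysVar.F0 μ ν (ρ ::ₘ σ ::ₘ J)))
  | trace (ν : Fin 4) (J : Multiset (Fin 4)) : TracelessRelator
      (∑ μ, ∑ ρ, eta μ ρ • FreeAlgebra.ι ℂ (PhysVar.F0 μ ν (ρ ::ₘ J)))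

/-- The polynomials in the formal variables `u` and `F⁽⁰⁾_{μν;J}`. -/
abbrev FormalP0 : Type := SuperPoly PhysVar.odd {r | TracelessRelator r}

/-- A variable of `FormalP0`. -/
def physGen (x : PhysVar) : FormalP0 := SuperPoly.gen PhysVar.odd {r | TracelessRelator r} x

/-- The value in `𝒫` of the formal variables. -/
def evalVar : PhysVar → P
  | .u => jet .u 0
  | .F0 μ ν J => F0 μ ν J

/-- The canonical map from the formal polynomials in `u` and `F⁽⁰⁾_{μν;J}` to `𝒫`. -/
def evalP0 : FormalP0 →ₐ[ℂ] P :=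
  SuperPoly.lift PhysVar.odd {r | TracelessRelator r} evalVar
    (by
      intro x y
      cases x <;> cases y
      · exact jet_mul_jet _ _ _ _
      · simpa [koszul, evalVar, PhysVar.odd] using jet_mul_F0 _ _ _ _ _
      · simpa [koszul, evalVar, PhysVar.odd] using (jet_mul_F0 _ _ _ _ _).symm
      · simpa [koszul, evalVar, PhysVar.odd] using F0_mul_F0 _ _ _ _ _ _)
    (by
      intro r hr
      cases hr with
      | antisymm μ ν J => simpa [evalVar] using F0_antisymm μ ν J
      | trace_deriv μ ν J => simpa [evalVar] using F0_trace_deriv μ ν J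
      | trace ν J => simpa [evalVar] using F0_trace ν J)

theorem evalP0_physGen (x : PhysVar) : evalP0 (physGen x) = evalVar x :=
  SuperPoly.lift_gen _ _ _ _ _ _

/-- The Bianchi identities. -/
inductive BianchiRel : FormalP0 → FormalP0 → Prop
  | bianchi (μ ν ρ : Fin 4) (J : Multiset (Fin 4)) : BianchiRel
      (physGen (.F0 μ ν (ρ ::ₘ J)) + physGen (.F0 ν ρ (μ ::ₘ J)) + physGen (.F0 ρ μ (ν ::ₘ J))) 0

/-- The polynomials in `u` and `F⁽⁰⁾_{μν;J}`, factorized to the ideal generated by the Bianchi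
identities. -/
def ReducedP0 : Type := RingQuot BianchiRel

instance : Ring ReducedP0 := inferInstanceAs (Ring (RingQuot BianchiRel))

instance : Algebra ℂ ReducedP0 := inferInstanceAs (Algebra ℂ (RingQuot BianchiRel))

/-- The projection to the factor space. -/
def ReducedP0.mk : FormalP0 →ₐ[ℂ] ReducedP0 := RingQuot.mkAlgHom ℂ BianchiRel

end

end GaugeCohomology

/-! The argument is of Hodge type. An odd derivation `homotopy`, written h, sends u-jets to v-jets,
v-jets to ũ-jets and ũ-jets to zero. Then Δ = d_Q h + h d_Q (`laplacian`) is an even derivation that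
commutes with d_Q. On every variable y it acts as Δy = y − ιπy (`laplacian_jet`). Here ι = `incl` is
the canonical map from the reduced algebra, and π = `proj` is an algebra map back: it kills ũ and
all derivatives of u, and replaces v by the radial-gauge potential of F⁽⁰⁾, as in the Poincaré
lemma.

Injectivity: πd_Q = 0 (`proj_dQ`), because tracelessness puts the radial potential in Lorenz gauge,
and πι = 1 (`proj_incl`), because by the Bianchi identity this potential has field strength F⁽⁰⁾. If
ιx is exact, then x = πιx = 0.

Surjectivity: Δ kills the image of ι and has eigenvalue 1 on each y − ιπy. Being a derivation, it
adds eigenvalues on products, so 𝒫 is the sum of the image of ι and of eigenspaces to positive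
integers (`spectralSum_eq_top`). Hence p + Δf(Δ)p = ιx for some polynomial f. If p is closed, so is
f(Δ)p, and Δf(Δ)p = d_Q h f(Δ)p is exact.

The formulas are easiest to read with formal series: a function of a multi-index gives the Taylor
coefficients of g(x), and prepending an index a is ∂_a. Then `erSum` is multiplication by x^ρ summed
over ρ, `box` is multiplication by x², and the field equation says that g is harmonic. -/

namespace GaugeCohomology

noncomputable section

/-! ### Sums over the entries of a multi-index -/

section ErSum

variable {E : Type} [AddCommGroup E]

/-- The sum of `G ρ K` over all ways to write `J = ρ ::ₘ K`, with multiplicity. -/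
def erSum (G : Fin 4 → Multiset (Fin 4) → E) (J : Multiset (Fin 4)) : E :=
  (J.map fun ρ => G ρ (J.erase ρ)).sum

theorem erSum_zero (G : Fin 4 → Multiset (Fin 4) → E) : erSum G 0 = 0 := by
  simp [erSum]

/-- The Leibniz rule for ∂_a on ∑ x^ρ g_ρ. -/
theorem erSum_cons (G : Fin 4 → Multiset (Fin 4) → E) (a : Fin 4) (J : Multiset (Fin 4)) :
    erSum G (a ::ₘ J) = G a J + erSum (fun ρ K => G ρ (a ::ₘ K)) J := by
  rw [erSum, Multiset.map_cons, Multiset.sum_cons, Multiset.erase_cons_head, erSum]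
  congr 2
  refine Multiset.map_congr rfl fun τ hτ => ?_
  rw [Multiset.erase_cons_tail_of_mem hτ]

theorem erSum_congr {G G' : Fin 4 → Multiset (Fin 4) → E} {J : Multiset (Fin 4)}
    (h : ∀ ρ K, J = ρ ::ₘ K → G ρ K = G' ρ K) : erSum G J = erSum G' J := by
  refine congrArg Multiset.sum (Multiset.map_congr rfl fun ρ hρ => ?_)
  exact h ρ _ (Multiset.cons_erase hρ).symm

theorem erSum_add (G G' : Fin 4 → Multiset (Fin 4) → E) (J : Multiset (Fin 4)) :
    erSum (fun ρ K => G ρ K + G' ρ K) J = erSum G J + erSum G' J := by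
  simp [erSum, Multiset.sum_map_add]

theorem erSum_sub (G G' : Fin 4 → Multiset (Fin 4) → E) (J : Multiset (Fin 4)) :
    erSum (fun ρ K => G ρ K - G' ρ K) J = erSum G J - erSum G' J := by
  simp [erSum, Multiset.sum_map_sub]

theorem erSum_const_zero (J : Multiset (Fin 4)) : erSum (fun _ _ => (0 : E)) J = 0 := by
  simp [erSum]

theorem erSum_comm (G : Fin 4 → Fin 4 → Multiset (Fin 4) → E) (J : Multiset (Fin 4)) :
    erSum (fun ρ K => erSum (fun τ L => G ρ τ L) K) J =
      erSum (fun ρ K => erSum (fun τ L => G τ ρ L) K) J := by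
  induction J using Multiset.induction generalizing G with
  | empty => simp [erSum_zero]
  | cons a J ih =>
    simp only [erSum_cons, erSum_add]
    rw [ih fun ρ τ L => G ρ τ (a ::ₘ L)]
    abel

theorem erSum_sum (G : Fin 4 → Fin 4 → Multiset (Fin 4) → E) (J : Multiset (Fin 4)) :
    ∑ a, erSum (G a) J = erSum (fun ρ K => ∑ a, G a ρ K) J := by
  simp only [Fin.sum_univ_four, erSum_add]

variable [Module ℂ E]

theorem map_erSum {E' : Type} [AddCommGroup E'] [Module ℂ E'] (f : E →ₗ[ℂ] E')
    (G : Fin 4 → Multiset (Fin 4) → E) (J : Multiset (Fin 4)) :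
    f (erSum G J) = erSum (fun ρ K => f (G ρ K)) J := by
  simp [erSum, map_multiset_sum, Multiset.map_map]

theorem erSum_smul (c : ℂ) (G : Fin 4 → Multiset (Fin 4) → E) (J : Multiset (Fin 4)) :
    erSum (fun ρ K => c • G ρ K) J = c • erSum G J :=
  (map_erSum (LinearMap.lsmul ℂ E c) G J).symm

/-- Euler's relation: x^ρ ∂_ρ multiplies the part of degree n by n. -/
theorem erSum_cons_self (f : Multiset (Fin 4) → E) (J : Multiset (Fin 4)) :
    erSum (fun ρ K => f (ρ ::ₘ K)) J = (J.card : ℂ) • f J := by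
  rw [erSum_congr (G' := fun _ _ => f J) (fun ρ K h => by rw [h])]
  simp [erSum, Nat.cast_smul_eq_nsmul]

end ErSum

section MulErSum

variable {A : Type} [Ring A] [Algebra ℂ A]

theorem mul_erSum (a : A) (G : Fin 4 → Multiset (Fin 4) → A) (J : Multiset (Fin 4)) :
    a * erSum G J = erSum (fun ρ K => a * G ρ K) J :=
  map_erSum (LinearMap.mulLeft ℂ a) G J

theorem erSum_mul (a : A) (G : Fin 4 → Multiset (Fin 4) → A) (J : Multiset (Fin 4)) :
    erSum G J * a = erSum (fun ρ K => G ρ K * a) J :=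
  map_erSum (LinearMap.mulRight ℂ a) G J

end MulErSum

/-! ### Contractions with the metric -/

/-- The diagonal entries of the metric. -/
def eps (a : Fin 4) : ℂ := if a = 0 then 1 else -1

theorem eta_eq (a b : Fin 4) : eta a b = if a = b then eps a else 0 := by
  simp [eta, eps]

theorem eta_comm (a b : Fin 4) : eta a b = eta b a := by
  unfold eta
  by_cases h : a = b <;> simp [h, eq_comm]

theorem eta_self (a : Fin 4) : eta a a = eps a := by simp [eta_eq]

theorem eps_mul_eps (a : Fin 4) : eps a * eps a = 1 := by
  unfold eps; split_ifs <;> norm_num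

section Contraction

variable {E : Type} [AddCommGroup E] [Module ℂ E]

theorem sum_eta (f : Fin 4 → Fin 4 → E) :
    ∑ ρ, ∑ σ, eta ρ σ • f ρ σ = ∑ a, eps a • f a a := by
  simp [eta_eq, ite_smul]

theorem sum_eps_eta (b : Fin 4) (f : Fin 4 → E) :
    ∑ a, eps a • eta a b • f a = f b := by
  simp [eta_eq, ite_smul, smul_smul, eps_mul_eps]

/-- The wave operator on functions of a multi-index. -/
def box (G : Multiset (Fin 4) → E) (J : Multiset (Fin 4)) : E :=
  erSum (fun ρ K => erSum (fun τ L => eta ρ τ • G L) K) J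

/-- ∂_a(x²g) = 2x_a g + x²∂_a g. -/
theorem box_cons (G : Multiset (Fin 4) → E) (a : Fin 4) (J : Multiset (Fin 4)) :
    box G (a ::ₘ J) = (2 : ℂ) • erSum (fun τ L => eta a τ • G L) J +
      box (fun L => G (a ::ₘ L)) J := by
  simp only [box, erSum_cons, erSum_add, eta_comm _ a]
  module

/-- In four dimensions □(x²g) = 4(E + 2)g + x²□g with E the Euler operator, and g is harmonic. This
fixes the trace corrections in `homotopyVar`. -/
theorem sum_eps_box (G : Multiset (Fin 4) → E)
    (hG : ∀ K, ∑ a, eps a • G (a ::ₘ a ::ₘ K) = 0) (J : Multiset (Fin 4)) :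
    ∑ a, eps a • box G (a ::ₘ a ::ₘ J) = (4 * ((J.card : ℂ) + 2)) • G J := by
  have h1 : ∑ a, eps a • erSum (fun τ L => eta a τ • G (a ::ₘ L)) J = (J.card : ℂ) • G J := by
    simp only [← erSum_smul, erSum_sum, sum_eps_eta, erSum_cons_self]
  have h2 : ∑ a, eps a • box (fun L => G (a ::ₘ a ::ₘ L)) J = 0 := by
    simp only [box, ← erSum_smul, erSum_sum, smul_comm (eps _)]
    simp only [← Finset.smul_sum, hG, smul_zero, erSum_const_zero]
  have h3 : ∑ a, eps a • (eta a a • G J) = (4 : ℂ) • G J := by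
    simp [eta_self, smul_smul, eps_mul_eps, ← Nat.cast_smul_eq_nsmul ℂ]
  have h4 : ∀ a, eps a • box G (a ::ₘ a ::ₘ J) = (2 : ℂ) • (eps a • (eta a a • G J)) +
      (4 : ℂ) • (eps a • erSum (fun τ L => eta a τ • G (a ::ₘ L)) J) +
      eps a • box (fun L => G (a ::ₘ a ::ₘ L)) J := fun a => by
    rw [box_cons, box_cons, erSum_cons]
    module
  simp only [h4, Finset.sum_add_distrib, ← Finset.smul_sum, h1, h2, h3]
  module

end Contraction

theorem sum_eps_jet (y : FieldName) (J : Multiset (Fin 4)) :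
    ∑ a, eps a • jet y (a ::ₘ a ::ₘ J) = 0 := by
  rw [← sum_eta fun a b => jet y (a ::ₘ b ::ₘ J)]
  exact jet_onShell y J

theorem B_eq (J : Multiset (Fin 4)) : B J = ∑ a, eps a • jet (.v a) (a ::ₘ J) :=
  sum_eta fun a b => jet (.v b) (a ::ₘ J)

theorem sum_eps_B (J : Multiset (Fin 4)) : ∑ a, eps a • B (a ::ₘ a ::ₘ J) = 0 := by
  rw [← sum_eta fun a b => B (a ::ₘ b ::ₘ J)]
  exact B_onShell J

theorem traceTerm_eq (μ ν : Fin 4) (J : Multiset (Fin 4)) :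
    traceTerm μ ν J = erSum (fun ρ K => eta μ ρ • B (ν ::ₘ K) - eta ν ρ • B (μ ::ₘ K)) J := rfl

/-! ### Graded derivations of the on-shell algebra -/

/-- Compatibility of values on the jets with the relations: the derivation matrices respect the
field equations as soon as the values do. -/
theorem derivMatrix_onShell (k : Bool) (δ : JetVar → P)
    (h : ∀ y J, ∑ a, eps a • δ (y, a ::ₘ a ::ₘ J) = 0) (r : FreeAlgebra ℂ JetVar)
    (hr : r ∈ onShell) : FreeAlgebra.lift ℂ (derivMatrix JetVar.odd onShell k δ) r = 0 := by
  obtain ⟨y, J, rfl⟩ := hr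
  have h1 := sum_eps_jet y J
  have h2 := h y J
  have h5 : ∀ K, SuperPoly.gen JetVar.odd onShell (y, K) = jet y K := fun K => rfl
  rw [sum_eta fun a b => FreeAlgebra.ι ℂ ((y, a ::ₘ b ::ₘ J) : JetVar)]
  simp only [map_sum, map_smul, FreeAlgebra.lift_ι_apply]
  ext i j
  rw [Matrix.sum_apply]
  fin_cases i <;> fin_cases j <;>
    simp [derivMatrix, JetVar.odd, h5, h1, h2, smul_comm (eps _) (koszul _ _),
      ← Finset.smul_sum]

/-- Words in the jets span. -/
theorem P_induction {p : P → Prop} (one : p 1) (jet_mul : ∀ y J b, p b → p (jet y J * b))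
    (add : ∀ a b, p a → p b → p (a + b)) (smul : ∀ (c : ℂ) a, p a → p (c • a)) (a : P) : p a :=
  SuperPoly.induction JetVar.odd onShell one (fun x b hb => jet_mul x.1 x.2 b hb) add smul a

/-- The parity automorphism. -/
def parity : P →ₐ[ℂ] P :=
  SuperPoly.lift JetVar.odd onShell (fun x => koszul true x.1.odd • jet x.1 x.2)
    (fun x y => by
      have h := jet_mul_jet x.1 y.1 x.2 y.2
      simp only [smul_mul_assoc, mul_smul_comm, JetVar.odd, h]
      module)
    (by
      rintro r ⟨y, J, rfl⟩
      rw [sum_eta fun a b => FreeAlgebra.ι ℂ ((y, a ::ₘ b ::ₘ J) : JetVar)]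
      simp only [map_sum, map_smul, FreeAlgebra.lift_ι_apply, smul_comm (eps _) (koszul _ _),
        ← Finset.smul_sum, sum_eps_jet, smul_zero])

theorem parity_jet (y : FieldName) (J : Multiset (Fin 4)) :
    parity (jet y J) = koszul true y.odd • jet y J :=
  SuperPoly.lift_gen _ _ _ _ _ _

/-- An odd derivation of `𝒫`. -/
structure IsOddDerivation (D : P →ₗ[ℂ] P) : Prop where
  map_one : D 1 = 0
  jet_mul : ∀ y J b, D (jet y J * b) = D (jet y J) * b + koszul true y.odd • (jet y J * D b)

theorem IsOddDerivation.map_mul {D : P →ₗ[ℂ] P} (hD : IsOddDerivation D) (a b : P) :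
    D (a * b) = D a * b + parity a * D b := by
  induction a using P_induction with
  | one => simp [hD.map_one]
  | jet_mul y J a ih =>
    rw [mul_assoc, hD.jet_mul, ih, hD.jet_mul, _root_.map_mul, parity_jet]
    simp only [mul_add, add_mul, smul_add, smul_mul_assoc, mul_assoc, add_assoc]
  | add a a' ha ha' => simp only [add_mul, map_add, ha, ha']; abel
  | smul c a ha => simp only [smul_mul_assoc, map_smul, ha, smul_add]

theorem isOddDerivation_dQ : IsOddDerivation dQ :=
  ⟨dQ_one, fun y J b => by rw [dQ_jet_mul, dQ_jet]⟩

/-- The anticommutator of two odd derivations is an even derivation. -/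
theorem anticommutator_mul {D D' : P →ₗ[ℂ] P} (hD : IsOddDerivation D) (hD' : IsOddDerivation D')
    (h : ∀ y J, parity (D (jet y J)) = -koszul true y.odd • D (jet y J))
    (h' : ∀ y J, parity (D' (jet y J)) = -koszul true y.odd • D' (jet y J)) (a b : P) :
    (D ∘ₗ D' + D' ∘ₗ D) (a * b) =
      (D ∘ₗ D' + D' ∘ₗ D) a * b + a * (D ∘ₗ D' + D' ∘ₗ D) b := by
  have hk : ∀ y : FieldName, koszul true y.odd * koszul true y.odd = 1 := fun y => by
    cases y.odd <;> simp [koszul]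
  -- The cross terms, one derivation on the jet and the other on `b`, cancel because `D` and `D'`
  -- both reverse the parity of a jet.
  have key : ∀ y J b, (D ∘ₗ D' + D' ∘ₗ D) (jet y J * b) =
      (D ∘ₗ D' + D' ∘ₗ D) (jet y J) * b + jet y J * (D ∘ₗ D' + D' ∘ₗ D) b := fun y J b => by
    simp only [LinearMap.add_apply, LinearMap.comp_apply, hD.jet_mul, hD'.jet_mul, map_add,
      map_smul, hD.map_mul (D' _), hD'.map_mul (D _), h, h', smul_add, smul_smul, hk, one_smul,
      smul_mul_assoc, add_mul, mul_add]
    module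
  induction a using P_induction with
  | one => simp [hD.map_one, hD'.map_one]
  | jet_mul y J a ih =>
    rw [mul_assoc, key, ih, key]
    simp only [mul_add, add_mul, mul_assoc, add_assoc]
  | add a a' ha ha' => simp only [add_mul, map_add, ha, ha']; abel
  | smul c a ha => simp only [smul_mul_assoc, map_smul, ha, smul_add]

/-! ### The contracting homotopy -/

/-- The values of the homotopy on the jets. -/
def homotopyVar : JetVar → P
  -- In this case and the next, the `box` term subtracts the trace of the leading term, so that the
  -- values obey the field equations. Its coefficient balances the 2 of `sum_eps_erSum` against the
  -- 4(n + 2) of `sum_eps_box`.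
  | (.v σ, J) => (Complex.I / ((J.card : ℂ) + 1)) •
      (erSum (fun τ K => eta σ τ • jet .uTilde K) J -
        (1 / (2 * ((J.card : ℂ) + 1))) • box (jet .uTilde) (σ ::ₘ J))
  -- At `J = 0` division by zero yields 0: the underived ghost is killed and so stays in the kernel
  -- of the Laplacian.
  | (.u, J) => (-Complex.I / (J.card : ℂ)) •
      (erSum (fun ρ K => jet (.v ρ) K) J - (1 / (2 * (J.card : ℂ))) • box B J)
  | (.uTilde, _) => 0

theorem homotopyVar_mul_jet (x : JetVar) (y : FieldName) (K : Multiset (Fin 4)) :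
    homotopyVar x * jet y K = koszul (xor true x.odd) y.odd • (jet y K * homotopyVar x) := by
  obtain ⟨x, J⟩ := x
  cases x with
  | v σ =>
    simp only [homotopyVar, box, smul_mul_assoc, mul_smul_comm, sub_mul, mul_sub, erSum_mul,
      mul_erSum, jet_mul_jet .uTilde y, JetVar.odd, FieldName.odd, Bool.xor_false]
    simp only [smul_comm (eta _ _) (koszul _ _), erSum_smul]
    module
  | u =>
    have hv : ∀ ρ L, jet (.v ρ) L * jet y K = jet y K * jet (.v ρ) L := fun ρ L => by
      simp [jet_mul_jet (.v ρ) y, koszul, FieldName.odd]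
    simp only [homotopyVar, box, smul_mul_assoc, mul_smul_comm, sub_mul, mul_sub, erSum_mul,
      mul_erSum, hv, jet_mul_B, JetVar.odd, FieldName.odd, Bool.xor_self, koszul, Bool.false_and]
    simp
  | uTilde => simp [homotopyVar]

/-- □(x^ρ g_ρ) = 2∂^ρ g_ρ for harmonic g_ρ. -/
theorem sum_eps_erSum (G : Fin 4 → Multiset (Fin 4) → P)
    (hG : ∀ ρ K, ∑ a, eps a • G ρ (a ::ₘ a ::ₘ K) = 0) (J : Multiset (Fin 4)) :
    ∑ a, eps a • erSum G (a ::ₘ a ::ₘ J) = (2 : ℂ) • ∑ a, eps a • G a (a ::ₘ J) := by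
  have h : ∑ a, eps a • erSum (fun ρ K => G ρ (a ::ₘ a ::ₘ K)) J = 0 := by
    simp only [← erSum_smul, erSum_sum, hG, erSum_const_zero]
  simp only [erSum_cons, smul_add, Finset.sum_add_distrib, h]
  module

theorem homotopyVar_onShell (y : FieldName) (J : Multiset (Fin 4)) :
    ∑ a, eps a • homotopyVar (y, a ::ₘ a ::ₘ J) = 0 := by
  cases y with
  | v σ =>
    have h1 := sum_eps_erSum (fun τ K => eta σ τ • jet .uTilde K) (fun ρ K => by
      simp only [smul_comm (eps _), ← Finset.smul_sum, sum_eps_jet, smul_zero]) J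
    have h2 := sum_eps_box (jet .uTilde) (sum_eps_jet .uTilde) (σ ::ₘ J)
    have h3 := sum_eps_eta σ fun a => jet .uTilde (a ::ₘ J)
    have hc : ∀ a, σ ::ₘ a ::ₘ a ::ₘ J = a ::ₘ a ::ₘ σ ::ₘ J := fun a => by
      rw [Multiset.cons_swap σ, Multiset.cons_swap σ]
    have hn : (J.card : ℂ) + 1 + 1 + 1 ≠ 0 := by exact_mod_cast (by omega : J.card + 1 + 1 + 1 ≠ 0)
    simp only [eta_comm _ σ] at h3
    rw [h3] at h1
    simp only [homotopyVar, hc, Multiset.card_cons, smul_comm (eps _), ← Finset.smul_sum, smul_sub,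
      Finset.sum_sub_distrib, h1, h2]
    push_cast
    match_scalars
    field_simp
    ring
  | u =>
    have h1 := sum_eps_erSum (fun ρ K => jet (.v ρ) K) (fun ρ K => sum_eps_jet _ _) J
    have h2 := sum_eps_box B sum_eps_B J
    have hn : (J.card : ℂ) + 2 ≠ 0 := by exact_mod_cast (by omega : J.card + 2 ≠ 0)
    simp only [homotopyVar, Multiset.card_cons, smul_comm (eps _), ← Finset.smul_sum, smul_sub,
      Finset.sum_sub_distrib, h1, h2, ← B_eq]
    push_cast
    match_scalars
    field_simp
    ring
  | uTilde => simp [homotopyVar]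

/-- The homotopy, an odd derivation of `𝒫`. -/
def homotopy : P →ₗ[ℂ] P :=
  SuperPoly.derivation JetVar.odd onShell true homotopyVar
    (derivMatrix_swap _ _ _ _ fun x y => homotopyVar_mul_jet x y.1 y.2)
    (derivMatrix_onShell true homotopyVar homotopyVar_onShell)

theorem homotopy_jet (y : FieldName) (J : Multiset (Fin 4)) :
    homotopy (jet y J) = homotopyVar (y, J) :=
  SuperPoly.derivation_gen _ _ _ _ _ _ _

theorem isOddDerivation_homotopy : IsOddDerivation homotopy where
  map_one := SuperPoly.derivation_one _ _ _ _ _ _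
  jet_mul y J b := by
    rw [homotopy_jet]
    exact SuperPoly.derivation_gen_mul _ _ _ _ _ _ (y, J) b

theorem parity_B (J : Multiset (Fin 4)) : parity (B J) = B J := by
  simp [B_eq, parity_jet, koszul, FieldName.odd]

theorem parity_dQ_jet (y : FieldName) (J : Multiset (Fin 4)) :
    parity (dQ (jet y J)) = -koszul true y.odd • dQ (jet y J) := by
  cases y <;> simp [dQ_jet, dQVar, parity_jet, parity_B, koszul, FieldName.odd]

theorem parity_erSum (G : Fin 4 → Multiset (Fin 4) → P) (J : Multiset (Fin 4)) :
    parity (erSum G J) = erSum (fun ρ K => parity (G ρ K)) J :=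
  map_erSum parity.toLinearMap G J

theorem parity_homotopy_jet (y : FieldName) (J : Multiset (Fin 4)) :
    parity (homotopy (jet y J)) = -koszul true y.odd • homotopy (jet y J) := by
  cases y with
  | v σ =>
    simp only [homotopy_jet, homotopyVar, box, map_smul, map_sub, parity_erSum, parity_jet, koszul,
      FieldName.odd, smul_comm (eta _ _), erSum_smul]
    simp
    module
  | u =>
    simp [homotopy_jet, homotopyVar, box, parity_erSum, parity_jet, parity_B, koszul,
      FieldName.odd]
  | uTilde => simp [homotopy_jet, homotopyVar]

/-! ### The Laplacian and its values on the variables -/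

/-- The Laplacian `[d_Q, h]₊`. -/
def laplacian : P →ₗ[ℂ] P := dQ ∘ₗ homotopy + homotopy ∘ₗ dQ

theorem laplacian_mul (a b : P) : laplacian (a * b) = laplacian a * b + a * laplacian b :=
  anticommutator_mul isOddDerivation_dQ isOddDerivation_homotopy parity_dQ_jet parity_homotopy_jet
    a b

theorem dQ_homotopy_of_closed {p : P} (hp : dQ p = 0) : dQ (homotopy p) = laplacian p := by
  simp [laplacian, hp]

/-- With n = |J| the coefficient is i/(n + 2) · ((n + 4) − 2), where the −2 is the trace correction.
The normalization of h on v thus gives ũ eigenvalue 1. -/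
theorem homotopy_B (J : Multiset (Fin 4)) : homotopy (B J) = Complex.I • jet .uTilde J := by
  have h1 : ∑ a, eps a • erSum (fun τ K => eta a τ • jet .uTilde K) (a ::ₘ J) =
      ((J.card : ℂ) + 4) • jet .uTilde J := by
    have h3 : ∑ a, eps a • (eta a a • jet .uTilde J) = (4 : ℂ) • jet .uTilde J := by
      simp [eta_self, smul_smul, eps_mul_eps, ← Nat.cast_smul_eq_nsmul ℂ]
    simp only [erSum_cons, smul_add, Finset.sum_add_distrib, h3]
    simp only [← erSum_smul, erSum_sum, sum_eps_eta, erSum_cons_self]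
    module
  have h2 := sum_eps_box (jet .uTilde) (sum_eps_jet .uTilde) J
  have hn : (J.card : ℂ) + 1 + 1 ≠ 0 := by exact_mod_cast (by omega : J.card + 1 + 1 ≠ 0)
  simp only [B_eq, map_sum, map_smul, homotopy_jet, homotopyVar, Multiset.card_cons,
    smul_comm (eps _), ← Finset.smul_sum, smul_sub, Finset.sum_sub_distrib, h1, h2]
  push_cast
  match_scalars
  field_simp
  ring

theorem laplacian_uTilde (J : Multiset (Fin 4)) : laplacian (jet .uTilde J) = jet .uTilde J := by
  simp [laplacian, homotopy_jet, dQ_jet, homotopyVar, dQVar, homotopy_B, smul_smul]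

/-- The `B` term is closed, and d_Q of the leading term counts u_J once per entry of J, which the
factor 1/|J| undoes unless J is empty. -/
theorem laplacian_u (J : Multiset (Fin 4)) :
    laplacian (jet .u J) = if J = 0 then 0 else jet .u J := by
  have hB : dQ (box B J) = 0 := by
    simp only [box, map_erSum, map_smul, dQ_B, smul_zero, erSum_const_zero]
  have h1 : dQ (erSum (fun ρ K => jet (.v ρ) K) J) = (Complex.I * J.card) • jet .u J := by
    simp only [map_erSum, dQ_jet, dQVar, erSum_smul, erSum_cons_self, smul_smul]
  simp only [laplacian, LinearMap.add_apply, LinearMap.comp_apply, homotopy_jet, dQ_jet,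
    homotopyVar, dQVar, map_smul, map_sub, hB, h1, map_zero]
  split_ifs with h
  · simp [h]
  · have hn : (J.card : ℂ) ≠ 0 := by simpa using h
    match_scalars
    field_simp
    simp

/-- Without the trace terms this is the Poincaré homotopy formula: a gradient plus the radial
potential of F restores v. The `B` terms coming from ũ complete F to F⁽⁰⁾. -/
theorem laplacian_v (σ : Fin 4) (J : Multiset (Fin 4)) :
    laplacian (jet (.v σ) J) = jet (.v σ) J -
      (1 / ((J.card : ℂ) + 1)) • erSum (fun μ K => F0 μ σ K) J := by
  have hn : (J.card : ℂ) + 1 ≠ 0 := by exact_mod_cast (by omega : J.card + 1 ≠ 0)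
  have hd : ∀ K, dQ (jet .uTilde K) = (-Complex.I) • B K := fun K => by
    rw [dQ_jet, dQVar, neg_smul]
  have hbox : dQ (box (jet .uTilde) (σ ::ₘ J)) = (-Complex.I) • box B (σ ::ₘ J) := by
    simp only [box, map_erSum, map_smul, hd, smul_comm _ (-Complex.I), erSum_smul]
  have her : dQ (erSum (fun τ K => eta σ τ • jet .uTilde K) J) =
      (-Complex.I) • erSum (fun τ K => eta σ τ • B K) J := by
    simp only [map_erSum, map_smul, hd, smul_comm _ (-Complex.I), erSum_smul]
  have hF : erSum (fun μ K => F0 μ σ K) J = (J.card : ℂ) • jet (.v σ) J -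
      erSum (fun μ K => jet (.v μ) (σ ::ₘ K)) J + (1 / ((J.card : ℂ) + 1)) •
        (box (fun K => B (σ ::ₘ K)) J -
          ((J.card : ℂ) - 1) • erSum (fun τ K => eta σ τ • B K) J) := by
    -- After the two sums are exchanged, the inner one runs over the n − 1 remaining entries of J.
    have h1 : erSum (fun μ K => erSum (fun ρ L => eta σ ρ • B (μ ::ₘ L)) K) J =
        ((J.card : ℂ) - 1) • erSum (fun τ K => eta σ τ • B K) J := by
      rw [erSum_comm fun μ ρ L => eta σ ρ • B (μ ::ₘ L), ← erSum_smul]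
      refine erSum_congr fun ρ K h => ?_
      rw [erSum_smul, erSum_cons_self, h, Multiset.card_cons]
      push_cast
      module
    rw [← h1, box, ← erSum_sub, ← erSum_cons_self, ← erSum_sub, ← erSum_smul, ← erSum_add]
    refine erSum_congr fun μ K h => ?_
    rw [F0, F, traceTerm_eq, erSum_sub, h, Multiset.card_cons]
    -- Here |K| = n − 1, so the factor 1/(|K| + 2) of F⁽⁰⁾ is 1/(n + 1).
    congr 3
    push_cast
    ring
  simp only [laplacian, LinearMap.add_apply, LinearMap.comp_apply, homotopy_jet, dQ_jet,
    homotopyVar, dQVar, map_smul, map_sub, hbox, her, hF, Multiset.card_cons, erSum_cons,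
    box_cons B]
  push_cast
  match_scalars <;> field_simp <;> simp <;> ring

/-! ### The projection to the reduced algebra -/

/-- The tensor `F⁽⁰⁾_{μν;J}` of the reduced algebra. -/
def redF0 (μ ν : Fin 4) (J : Multiset (Fin 4)) : ReducedP0 :=
  ReducedP0.mk (physGen (.F0 μ ν J))

/-- The variable `u` of the reduced algebra. -/
def redU : ReducedP0 := ReducedP0.mk (physGen .u)

theorem redF0_antisymm (μ ν : Fin 4) (J : Multiset (Fin 4)) : redF0 μ ν J + redF0 ν μ J = 0 := by
  have h := SuperPoly.mk_eq_zero PhysVar.odd {r | TracelessRelator r}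
    (TracelessRelator.antisymm μ ν J)
  rw [redF0, redF0, ← map_add, physGen, physGen, ← SuperPoly.mk_ι, ← SuperPoly.mk_ι, ← map_add, h,
    map_zero]

theorem redF0_trace_deriv (μ ν : Fin 4) (J : Multiset (Fin 4)) :
    ∑ a, eps a • redF0 μ ν (a ::ₘ a ::ₘ J) = 0 := by
  have h := SuperPoly.mk_eq_zero PhysVar.odd {r | TracelessRelator r}
    (TracelessRelator.trace_deriv μ ν J)
  rw [sum_eta fun a b => FreeAlgebra.ι ℂ (PhysVar.F0 μ ν (a ::ₘ b ::ₘ J))] at h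
  have h' := congrArg ReducedP0.mk h
  simp only [map_sum, map_smul, map_zero] at h'
  exact h'

theorem redF0_trace (ν : Fin 4) (J : Multiset (Fin 4)) :
    ∑ a, eps a • redF0 a ν (a ::ₘ J) = 0 := by
  have h := SuperPoly.mk_eq_zero PhysVar.odd {r | TracelessRelator r} (TracelessRelator.trace ν J)
  rw [sum_eta fun a b => FreeAlgebra.ι ℂ (PhysVar.F0 a ν (b ::ₘ J))] at h
  have h' := congrArg ReducedP0.mk h
  simp only [map_sum, map_smul, map_zero] at h'
  exact h'

theorem redF0_bianchi (μ ν ρ : Fin 4) (J : Multiset (Fin 4)) :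
    redF0 μ ν (ρ ::ₘ J) + redF0 ν ρ (μ ::ₘ J) + redF0 ρ μ (ν ::ₘ J) = 0 := by
  have h : ReducedP0.mk (physGen (.F0 μ ν (ρ ::ₘ J)) + physGen (.F0 ν ρ (μ ::ₘ J)) +
      physGen (.F0 ρ μ (ν ::ₘ J))) = ReducedP0.mk 0 :=
    RingQuot.mkAlgHom_rel ℂ (BianchiRel.bianchi μ ν ρ J)
  simp only [map_add, map_zero] at h
  exact h

theorem redF0_self (μ : Fin 4) (J : Multiset (Fin 4)) : redF0 μ μ J = 0 := by
  have h : (2 : ℂ) • redF0 μ μ J = 0 := by rw [two_smul, redF0_antisymm]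
  exact (smul_eq_zero.1 h).resolve_left two_ne_zero

theorem physGen_mul_physGen (x y : PhysVar) :
    physGen x * physGen y = koszul x.odd y.odd • (physGen y * physGen x) :=
  SuperPoly.gen_mul_gen _ _ _ _

theorem redF0_mul_redF0 (μ ν : Fin 4) (J : Multiset (Fin 4)) (μ' ν' : Fin 4)
    (J' : Multiset (Fin 4)) : redF0 μ ν J * redF0 μ' ν' J' = redF0 μ' ν' J' * redF0 μ ν J := by
  rw [redF0, redF0, ← map_mul, physGen_mul_physGen, map_smul, map_mul]
  simp [koszul, PhysVar.odd]

theorem redU_mul_redF0 (μ ν : Fin 4) (J : Multiset (Fin 4)) :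
    redU * redF0 μ ν J = redF0 μ ν J * redU := by
  rw [redF0, redU, ← map_mul, physGen_mul_physGen, map_smul, map_mul]
  simp [koszul, PhysVar.odd]

theorem redU_mul_redU : redU * redU = -(redU * redU) := by
  have h := congrArg ReducedP0.mk (physGen_mul_physGen .u .u)
  simp only [map_mul, map_smul] at h
  exact h.trans (by simp [koszul, PhysVar.odd, redU])

/-- The values of the projection on the jets. -/
def projVar : JetVar → ReducedP0
  -- Taylor coefficients of the radial potential ∫₀¹ t x^μ F⁽⁰⁾_{μσ}(tx) dt; the underived v goes to
  -- 0.
  | (.v σ, J) => (1 / ((J.card : ℂ) + 1)) • erSum (fun μ K => redF0 μ σ K) J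
  | (.u, J) => if J = 0 then redU else 0
  | (.uTilde, _) => 0

theorem projVar_v_mul (σ : Fin 4) (J : Multiset (Fin 4)) (a : ReducedP0)
    (ha : ∀ μ ν K, redF0 μ ν K * a = a * redF0 μ ν K) :
    projVar (.v σ, J) * a = a * projVar (.v σ, J) := by
  simp only [projVar, smul_mul_assoc, mul_smul_comm, erSum_mul, mul_erSum, ha]

theorem projVar_mul_projVar (x y : JetVar) :
    projVar x * projVar y = koszul x.odd y.odd • (projVar y * projVar x) := by
  obtain ⟨x, J⟩ := x
  obtain ⟨y, K⟩ := y
  have hv : ∀ σ J y K, projVar (.v σ, J) * projVar (y, K) = projVar (y, K) * projVar (.v σ, J) :=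
    fun σ J y K => projVar_v_mul _ _ _ fun μ ν L => by
      cases y with
      | v τ => exact (projVar_v_mul _ _ _ fun _ _ _ => redF0_mul_redF0 _ _ _ _ _ _).symm
      | u => by_cases hK : K = 0 <;> simp [projVar, hK, redU_mul_redF0]
      | uTilde => simp [projVar]
  cases x with
  | v σ => simp [hv, koszul, JetVar.odd, FieldName.odd]
  | uTilde => simp [projVar]
  | u =>
    cases y with
    | v σ => simp [hv, koszul, JetVar.odd, FieldName.odd]
    | uTilde => simp [projVar]
    | u =>
      by_cases hJ : J = 0 <;> by_cases hK : K = 0 <;>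
        simp [projVar, hJ, hK, koszul, JetVar.odd, FieldName.odd]
      exact redU_mul_redU

theorem projVar_onShell (y : FieldName) (J : Multiset (Fin 4)) :
    ∑ a, eps a • projVar (y, a ::ₘ a ::ₘ J) = 0 := by
  cases y with
  | v σ =>
    simp only [projVar, Multiset.card_cons, smul_comm (eps _), ← Finset.smul_sum, erSum_cons,
      smul_add, Finset.sum_add_distrib, redF0_trace, ← erSum_smul, erSum_sum, redF0_trace_deriv,
      erSum_const_zero, add_zero, smul_zero]
  | u => simp [projVar]
  | uTilde => simp [projVar]

/-- The projection of `𝒫` to the reduced algebra. -/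
def proj : P →ₐ[ℂ] ReducedP0 :=
  SuperPoly.lift JetVar.odd onShell projVar projVar_mul_projVar (by
    rintro r ⟨y, J, rfl⟩
    rw [sum_eta fun a b => FreeAlgebra.ι ℂ ((y, a ::ₘ b ::ₘ J) : JetVar)]
    simpa only [map_sum, map_smul, FreeAlgebra.lift_ι_apply] using projVar_onShell y J)

theorem proj_jet (y : FieldName) (J : Multiset (Fin 4)) : proj (jet y J) = projVar (y, J) :=
  SuperPoly.lift_gen _ _ _ _ _ _

/-- The radial potential is divergence-free: the derivative on x^μ gives a diagonal entry of an
antisymmetric tensor, and the derivative on F⁽⁰⁾ gives a trace. -/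
theorem proj_B (J : Multiset (Fin 4)) : proj (B J) = 0 := by
  have h : ∀ μ K, ∑ a, eps a • redF0 μ a (a ::ₘ K) = 0 := fun μ K => by
    rw [← neg_eq_zero, ← Finset.sum_neg_distrib, ← redF0_trace μ K]
    refine Finset.sum_congr rfl fun a _ => ?_
    rw [← smul_neg, ← eq_neg_of_add_eq_zero_left (redF0_antisymm a μ _)]
  simp only [B_eq, map_sum, map_smul, proj_jet, projVar, Multiset.card_cons, erSum_cons, redF0_self,
    zero_add, smul_comm (eps _), ← Finset.smul_sum]
  simp only [← erSum_smul, erSum_sum, h, erSum_const_zero, smul_zero]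

/-- On variables d_Q yields only derivatives of u and jets of B, all killed by π; multiplicativity
does the rest. -/
theorem proj_dQ (p : P) : proj (dQ p) = 0 := by
  induction p using P_induction with
  | one => simp [dQ_one]
  | jet_mul y J b ih =>
    have h : proj (dQVar (y, J)) = 0 := by
      cases y <;> simp [dQVar, proj_jet, projVar, proj_B]
    rw [dQ_jet_mul, map_add, map_mul, map_smul, map_mul, h, ih]
    simp
  | add a b ha hb => simp [ha, hb]
  | smul c a ha => simp [ha]

/-- The `B` terms drop out. In the curl, derivatives on x^ρ contribute 2F⁽⁰⁾, and the Bianchi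
identity turns the other terms into nF⁽⁰⁾, which cancels 1/(n + 2). -/
theorem proj_F0 (μ ν : Fin 4) (J : Multiset (Fin 4)) : proj (F0 μ ν J) = redF0 μ ν J := by
  have ht : proj (traceTerm μ ν J) = 0 := by
    have h := map_erSum proj.toLinearMap
      (fun ρ K => eta μ ρ • B (ν ::ₘ K) - eta ν ρ • B (μ ::ₘ K)) J
    simp only [AlgHom.toLinearMap_apply, map_sub, map_smul, proj_B, smul_zero, sub_zero,
      erSum_const_zero] at h
    exact h
  have hs : erSum (fun ρ K => redF0 ρ ν (μ ::ₘ K)) J - erSum (fun ρ K => redF0 ρ μ (ν ::ₘ K)) J =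
      (J.card : ℂ) • redF0 μ ν J := by
    rw [← erSum_sub, ← erSum_cons_self (redF0 μ ν)]
    refine erSum_congr fun ρ K _ => ?_
    linear_combination (norm := abel) redF0_antisymm ρ ν (μ ::ₘ K) - redF0_bianchi μ ν ρ K
  have hn : (J.card : ℂ) + 1 + 1 ≠ 0 := by exact_mod_cast (by omega : J.card + 1 + 1 ≠ 0)
  have ha := eq_neg_of_add_eq_zero_right (redF0_antisymm μ ν J)
  rw [F0, F, map_add, map_sub, map_smul, ht, proj_jet, proj_jet, projVar, projVar,
    Multiset.card_cons, Multiset.card_cons, erSum_cons, erSum_cons, eq_add_of_sub_eq hs, ha]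
  push_cast
  match_scalars <;> field_simp <;> ring

/-! ### The inclusion of the reduced algebra -/

/-- The canonical map from the reduced algebra to `𝒫`. -/
def incl : ReducedP0 →ₐ[ℂ] P :=
  RingQuot.liftAlgHom ℂ ⟨evalP0, by
    rintro _ _ ⟨μ, ν, ρ, J⟩
    simpa only [map_add, map_zero, evalP0_physGen, evalVar] using F0_bianchi μ ν ρ J⟩

theorem incl_mk (x : FormalP0) : incl (ReducedP0.mk x) = evalP0 x :=
  RingQuot.liftAlgHom_mkAlgHom_apply ℂ _ _ _

theorem ReducedP0.mk_surjective : Function.Surjective ReducedP0.mk :=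
  RingQuot.mkAlgHom_surjective ℂ BianchiRel

theorem incl_redF0 (μ ν : Fin 4) (J : Multiset (Fin 4)) : incl (redF0 μ ν J) = F0 μ ν J := by
  rw [redF0, incl_mk, evalP0_physGen, evalVar]

theorem incl_redU : incl redU = jet .u 0 := by
  rw [redU, incl_mk, evalP0_physGen, evalVar]

/-- Words in `u` and the `F⁽⁰⁾_{μν;J}` span. -/
theorem ReducedP0.induction {p : ReducedP0 → Prop} (one : p 1) (u_mul : ∀ b, p b → p (redU * b))
    (F0_mul : ∀ μ ν J b, p b → p (redF0 μ ν J * b)) (add : ∀ a b, p a → p b → p (a + b))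
    (smul : ∀ (c : ℂ) a, p a → p (c • a)) (a : ReducedP0) : p a := by
  obtain ⟨a, rfl⟩ := ReducedP0.mk_surjective a
  induction a using SuperPoly.induction with
  | one => simpa using one
  | gen_mul x b hb =>
    rw [map_mul]
    cases x with
    | u => exact u_mul _ hb
    | F0 μ ν J => exact F0_mul μ ν J _ hb
  | add a b ha hb => simpa using add _ _ ha hb
  | smul c a ha => simpa using smul c _ ha

theorem proj_incl (x : ReducedP0) : proj (incl x) = x := by
  induction x using ReducedP0.induction with
  | one => simp
  | u_mul b hb => simp [incl_redU, proj_jet, projVar, hb]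
  | F0_mul μ ν J b hb => simp [incl_redF0, proj_F0, hb]
  | add a b ha hb => simp [ha, hb]
  | smul c a ha => simp [ha]

theorem dQ_incl (x : ReducedP0) : dQ (incl x) = 0 := by
  induction x using ReducedP0.induction with
  | one => simp [dQ_one]
  | u_mul b hb => simp [incl_redU, dQ_jet_mul, dQVar, hb]
  | F0_mul μ ν J b hb => simp [incl_redF0, isOddDerivation_dQ.map_mul, dQ_F0, hb]
  | add a b ha hb => simp [ha, hb]
  | smul c a ha => simp [ha]

theorem incl_mem_P0 (x : ReducedP0) : incl x ∈ P0 := by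
  induction x using ReducedP0.induction with
  | one => simp
  | u_mul b hb =>
    rw [map_mul, incl_redU]
    exact mul_mem (Algebra.subset_adjoin (Or.inl rfl)) hb
  | F0_mul μ ν J b hb =>
    rw [map_mul, incl_redF0]
    exact mul_mem (Algebra.subset_adjoin (Or.inr ⟨μ, ν, J, rfl⟩)) hb
  | add a b ha hb => simpa using add_mem ha hb
  | smul c a ha => simpa using P0.smul_mem ha c

/-! ### The spectral decomposition of the Laplacian -/

theorem incl_erSum (G : Fin 4 → Multiset (Fin 4) → ReducedP0) (J : Multiset (Fin 4)) :
    incl (erSum G J) = erSum (fun ρ K => incl (G ρ K)) J :=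
  map_erSum incl.toLinearMap G J

theorem laplacian_jet (y : FieldName) (J : Multiset (Fin 4)) :
    laplacian (jet y J) = jet y J - incl (proj (jet y J)) := by
  cases y with
  | v σ => simp only [laplacian_v, proj_jet, projVar, map_smul, incl_erSum, incl_redF0]
  | u =>
    rw [laplacian_u, proj_jet, projVar]
    split_ifs with h <;> simp [incl_redU, h]
  | uTilde => simp [laplacian_uTilde, proj_jet, projVar]

/-- The linear span of the jets. -/
def linearPart : Submodule ℂ P := Submodule.span ℂ {x | ∃ y J, x = jet y J}

/-- Extends the formula by linearity to F⁽⁰⁾, which is no single jet but is fixed by ιπ, hence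
annihilated by Δ. -/
theorem laplacian_of_mem_linearPart {p : P} (hp : p ∈ linearPart) :
    laplacian p = p - incl (proj p) := by
  induction hp using Submodule.span_induction with
  | mem x h => obtain ⟨y, J, rfl⟩ := h; exact laplacian_jet y J
  | zero => simp
  | add a b _ _ ha hb => simp only [map_add, ha, hb]; abel
  | smul c a _ ha => simp only [map_smul, ha, smul_sub]

theorem jet_mem_linearPart (y : FieldName) (J : Multiset (Fin 4)) : jet y J ∈ linearPart :=
  Submodule.subset_span ⟨y, J, rfl⟩

theorem B_mem_linearPart (J : Multiset (Fin 4)) : B J ∈ linearPart := by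
  rw [B_eq]
  exact Submodule.sum_mem _ fun a _ => Submodule.smul_mem _ _ (jet_mem_linearPart _ _)

theorem F0_mem_linearPart (μ ν : Fin 4) (J : Multiset (Fin 4)) : F0 μ ν J ∈ linearPart := by
  refine add_mem (sub_mem (jet_mem_linearPart _ _) (jet_mem_linearPart _ _))
    (Submodule.smul_mem _ _ (multiset_sum_mem _ fun z hz => ?_))
  obtain ⟨ρ, -, rfl⟩ := Multiset.mem_map.1 hz
  exact sub_mem (Submodule.smul_mem _ _ (B_mem_linearPart _))
    (Submodule.smul_mem _ _ (B_mem_linearPart _))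

theorem laplacian_F0 (μ ν : Fin 4) (J : Multiset (Fin 4)) : laplacian (F0 μ ν J) = 0 := by
  rw [laplacian_of_mem_linearPart (F0_mem_linearPart μ ν J), proj_F0, incl_redF0, sub_self]

theorem laplacian_one : laplacian 1 = 0 := by
  simp [laplacian, dQ_one, isOddDerivation_homotopy.map_one]

theorem laplacian_incl (x : ReducedP0) : laplacian (incl x) = 0 := by
  induction x using ReducedP0.induction with
  | one => simp [laplacian_one]
  | u_mul b hb => simp [laplacian_mul, incl_redU, laplacian_u, hb]
  | F0_mul μ ν J b hb => simp [laplacian_mul, incl_redF0, laplacian_F0, hb]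
  | add a b ha hb => simp [ha, hb]
  | smul c a ha => simp [ha]

/-- The sum of the image of the reduced algebra and the eigenspaces of the Laplacian to positive
integers. -/
def spectralSum : Submodule ℂ P :=
  LinearMap.range incl.toLinearMap ⊔ ⨆ n : ℕ, Module.End.eigenspace laplacian ((n : ℂ) + 1)

theorem incl_mem_spectralSum (x : ReducedP0) : incl x ∈ spectralSum :=
  Submodule.mem_sup_left ⟨x, rfl⟩

theorem mem_spectralSum {p : P} (n : ℕ) (hp : laplacian p = ((n : ℂ) + 1) • p) :
    p ∈ spectralSum :=
  Submodule.mem_sup_right (Submodule.mem_iSup_of_mem n (Module.End.mem_eigenspace_iff.2 hp))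

/-- A jet y is ιπy, of eigenvalue 0, plus y − ιπy, of eigenvalue 1; eigenvalues add under
multiplication. -/
theorem jet_mul_mem_spectralSum (y : FieldName) (J : Multiset (Fin 4)) {p : P}
    (hp : p ∈ spectralSum) : jet y J * p ∈ spectralSum := by
  have hc : laplacian (jet y J - incl (proj (jet y J))) = jet y J - incl (proj (jet y J)) := by
    rw [map_sub, laplacian_incl, sub_zero, laplacian_jet]
  have hj : ∀ p, jet y J * p =
      incl (proj (jet y J)) * p + (jet y J - incl (proj (jet y J))) * p := fun p => by
    rw [← add_mul, add_sub_cancel]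
  suffices h : spectralSum ≤ spectralSum.comap (LinearMap.mulLeft ℂ (jet y J)) from h hp
  refine sup_le ?_ (iSup_le fun n => ?_)
  · rintro _ ⟨x, rfl⟩
    rw [Submodule.mem_comap, LinearMap.mulLeft_apply, AlgHom.toLinearMap_apply, hj, ← map_mul]
    -- Index `n` stands for eigenvalue n + 1, so `0` means eigenvalue 1.
    refine add_mem (incl_mem_spectralSum _) (mem_spectralSum 0 ?_)
    rw [laplacian_mul, hc, laplacian_incl]
    simp
  · intro p hp
    rw [Module.End.mem_eigenspace_iff] at hp
    rw [Submodule.mem_comap, LinearMap.mulLeft_apply, hj]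
    refine add_mem (mem_spectralSum n ?_) (mem_spectralSum (n + 1) ?_)
    · rw [laplacian_mul, laplacian_incl, hp, zero_mul, zero_add, mul_smul_comm]
    · rw [laplacian_mul, hc, hp, mul_smul_comm]
      push_cast
      module

theorem spectralSum_eq_top : spectralSum = ⊤ := by
  refine Submodule.eq_top_iff'.2 fun p => ?_
  induction p using P_induction with
  | one => exact map_one incl ▸ incl_mem_spectralSum 1
  | jet_mul y J b hb => exact jet_mul_mem_spectralSum y J hb
  | add a b ha hb => exact add_mem ha hb
  | smul c a ha => exact Submodule.smul_mem _ _ ha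

theorem dQ_laplacian (p : P) : dQ (laplacian p) = laplacian (dQ p) := by
  simp [laplacian, dQ_dQ]

open Polynomial in
theorem dQ_aeval_laplacian (f : ℂ[X]) (p : P) :
    dQ (aeval laplacian f p) = aeval laplacian f (dQ p) := by
  induction f using Polynomial.induction_on generalizing p with
  | C a => simp [Module.algebraMap_end_apply]
  | add f g hf hg => simp [hf, hg]
  | monomial n a ih =>
    rw [pow_succ, ← mul_assoc, map_mul, Module.End.mul_apply, ih, aeval_X, dQ_laplacian,
      Module.End.mul_apply]

open Polynomial in
/-- Some polynomial in the Laplacian with constant term `1` maps a given element to the image of the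
reduced algebra. -/
theorem exists_polynomial_laplacian (p : P) :
    ∃ f : ℂ[X], ∃ x, p + laplacian (aeval laplacian f p) = incl x := by
  have hp : p ∈ spectralSum := spectralSum_eq_top ▸ Submodule.mem_top
  -- Δ kills the image of ι, so only the constant term acts there.
  have key : ∀ (f : ℂ[X]) x, aeval laplacian f (incl x) = f.coeff 0 • incl x := fun f x => by
    induction f using Polynomial.induction_on with
    | C a => simp [Module.algebraMap_end_apply]
    | add f g hf hg => simp [hf, hg, add_smul]
    | monomial n a _ => simp [pow_succ, laplacian_incl]
  have hcomm : ∀ (f : ℂ[X]) p, laplacian (aeval laplacian f p) = aeval laplacian (X * f) p :=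
    fun f p => by simp
  have hadd : ∀ p q : P, (∃ f : ℂ[X], ∃ x, p + laplacian (aeval laplacian f p) = incl x) →
      (∃ f : ℂ[X], ∃ x, q + laplacian (aeval laplacian f q) = incl x) →
      ∃ f : ℂ[X], ∃ x, p + q + laplacian (aeval laplacian f (p + q)) = incl x := by
    rintro p q ⟨f, x, hf⟩ ⟨g, y, hg⟩
    -- The witness comes from (1 + Xf)(1 + Xg): each factor maps its own summand into the image of
    -- ι, where the other factor is the identity.
    refine ⟨f + g + X * f * g, x + y, ?_⟩
    have h1 : aeval laplacian (1 + X * f) p = incl x := by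
      rw [map_add, LinearMap.add_apply, ← hcomm, hf.symm]; simp
    have h2 : aeval laplacian (1 + X * g) q = incl y := by
      rw [map_add, LinearMap.add_apply, ← hcomm, hg.symm]; simp
    have h3 : ∀ r, r + laplacian (aeval laplacian (f + g + X * f * g) r) =
        aeval laplacian ((1 + X * f) * (1 + X * g)) r := fun r => by
      rw [hcomm, show (1 + X * f) * (1 + X * g) = 1 + X * (f + g + X * f * g) by ring,
        map_add (aeval laplacian) 1]
      simp
    rw [h3, map_add, map_add]
    congr 1
    · rw [mul_comm, map_mul, Module.End.mul_apply, h1, key]; simp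
    · rw [map_mul, Module.End.mul_apply, h2, key]; simp
  rw [spectralSum] at hp
  obtain ⟨_, ⟨x, rfl⟩, q, hq, rfl⟩ := Submodule.mem_sup.1 hp
  refine hadd _ _ ⟨0, x, by simp⟩ ?_
  clear hp
  induction hq using Submodule.iSup_induction' with
  | mem n q hq =>
    rw [Module.End.mem_eigenspace_iff] at hq
    have hn : (n : ℂ) + 1 ≠ 0 := by exact_mod_cast n.succ_ne_zero
    -- Chosen so that 1 + Xf vanishes at the eigenvalue n + 1.
    refine ⟨C (-((n : ℂ) + 1)⁻¹), 0, ?_⟩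
    simp [Module.algebraMap_end_apply, hq, smul_smul, hn]
  | zero => exact ⟨0, 0, by simp⟩
  | add p q _ _ hp hq => exact hadd _ _ hp hq

/-- Every cocycle is cohomologous to an element of the reduced algebra. -/
theorem exists_sub_incl_mem_BQ {p : P} (hp : p ∈ ZQ) : ∃ x, p - incl x ∈ BQ := by
  obtain ⟨f, x, hx⟩ := exists_polynomial_laplacian p
  have hp' : dQ (Polynomial.aeval laplacian f p) = 0 := by
    rw [dQ_aeval_laplacian, show dQ p = 0 from hp, map_zero]
  -- p − ιx = −Δf(Δ)p, and Δ = d_Q h on the closed element f(Δ)p.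
  refine ⟨x, -homotopy (Polynomial.aeval laplacian f p), ?_⟩
  rw [map_neg, dQ_homotopy_of_closed hp', ← hx]
  abel

/-! ### The cohomology -/

/-- The map induced in cohomology. -/
def inclHQ : ReducedP0 →ₗ[ℂ] HQ :=
  HQ.mk ∘ₗ incl.toLinearMap.codRestrict ZQ dQ_incl

/-- π kills coboundaries and is a left inverse of ι. -/
theorem inclHQ_injective : Function.Injective inclHQ := by
  refine (injective_iff_map_eq_zero _).2 fun x hx => ?_
  obtain ⟨p, hp⟩ := (Submodule.Quotient.mk_eq_zero _).1 hx
  rw [← proj_incl x]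
  exact (congrArg proj hp).symm.trans (proj_dQ p)

theorem inclHQ_surjective : Function.Surjective inclHQ := by
  intro z
  obtain ⟨⟨p, hp⟩, rfl⟩ := Submodule.mkQ_surjective _ z
  obtain ⟨x, hx⟩ := exists_sub_incl_mem_BQ hp
  refine ⟨x, ((Submodule.Quotient.eq _).2 ?_).symm⟩
  exact hx

end

end GaugeCohomology

theorem mainTheorem3 :
    (∀ p ∈ GaugeCohomology.ZQ, ∃ p₀ ∈ GaugeCohomology.P0, p - p₀ ∈ GaugeCohomology.BQ) ∧
    ∃ e : GaugeCohomology.ReducedP0 ≃ₗ[ℂ] GaugeCohomology.HQ,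
      ∀ x : GaugeCohomology.FormalP0, ∃ hx : GaugeCohomology.evalP0 x ∈ GaugeCohomology.ZQ,
        e (GaugeCohomology.ReducedP0.mk x) =
          GaugeCohomology.HQ.mk ⟨GaugeCohomology.evalP0 x, hx⟩ := by
  refine ⟨fun p hp => ?_, LinearEquiv.ofBijective GaugeCohomology.inclHQ
    ⟨GaugeCohomology.inclHQ_injective, GaugeCohomology.inclHQ_surjective⟩, fun x => ?_⟩
  · obtain ⟨x, hx⟩ := GaugeCohomology.exists_sub_incl_mem_BQ hp
    exact ⟨_, GaugeCohomology.incl_mem_P0 x, hx⟩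
  · have h := GaugeCohomology.incl_mk x
    refine ⟨h ▸ GaugeCohomology.dQ_incl _, ?_⟩
    exact congrArg GaugeCohomology.HQ.mk (Subtype.ext h)
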